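/- \textbf{Definitions.} For a partition $p$ and a partition $q$ of $\{1,\dots,n\}$, the meeting graph is the bipartite multigraph whose upper vertices are the classes of $p$, whose lower vertices are the classes of $q$, and which has for each $j\in\{1,\dots,n\}$ one edge joining the class of $j$ in $p$ to the class of $j$ in $q$. Write $p\perp q$ if it is connected and acyclic, and $P^{\perp}=\{q\mid \forall p\in P,\ p\perp q\}$ for a set $P$ of partitions. A pair $(\mathcal C,\mathcal C^{*})$ of dual $n$-ary generalized connectives is a pair of non-empty sets $P_{\mathcal C},P_{\mathcal C^{*}}$ of partitions of $\{1,\dots,n\}$ with $P_{\mathcal C}^{\perp}=P_{\mathcal C^{*}}$ and $P_{\mathcal C^{*}}^{\perp}=P_{\mathcal C}$. Write $\otimes$ for tensor and $\wp$ for par, and put $P_{\otimes}=\{\{(1),(2)\}\}$ and $P_{\wp}=\{\{(1,2)\}\}$. Fix a family of such pairs $(\mathcal C_i,\mathcal C_i^{*})$, of arities $m_i$. Formulas of $\mathsf{MLL}(\mathcal C_i)$ are built from propositional variables $P_k$ and their negations ${\sim}P_k$ ($k\in\mathbb N$) by $\otimes$, $\wp$, $\mathcal C_i$ and $\mathcal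 C_i^{*}$; the dual ${\sim}A$ is given by the De Morgan rules, exchanging $\otimes$ with $\wp$ and $\mathcal C_i$ with $\mathcal C_i^{*}$. Sequents are finite multisets of formulas. The rules are the axioms $\vdash P_k,{\sim}P_k$, the cut rule (from $\vdash\Gamma,A$ and $\vdash\Delta,{\sim}A$ infer $\vdash\Gamma,\Delta$), and, for each connective $\mathcal C$ (including $\otimes$, $\wp$ and the duals) and each $p\in P_{\mathcal C}$, the rule that infers $\vdash\Gamma_1,\dots,\Gamma_k,\mathcal C(A_1,\dots,A_n)$ from the premises $\vdash\Gamma_x,(A_j)_{j\in p_x}$, one for each class $p_x$ of $p=\{p_1,\dots,p_k\}$. A proof-structure is a non-empty finite set of nodes labelled by formulas, with axiom links (two conclusions $P_k,{\sim}P_k$), cut links (two premises $A,{\sim}A$) and connective links (ordered premises $A_1,\dots,A_n$ and conclusion $\mathcal C(A_1,\dots,A_n)$), such that each node is the conclusion of exactly one link and stands in at most one premise position of a link. A proof $\pi$ translates to a proof-structure in the usual way, rule by rule: an axiom becomes an axiom link; a cut, respectively a connective rule, becomes the disjoint union of translations of its premises with one new cut link, respectively connective link, on the terminal nodes that the rule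 acts on. A proof-structure is \emph{sequentializable} if it is, up to isomorphism, the translation of a proof of $\mathsf{MLL}(\mathcal C_i)$. A \emph{partition switching} $I$ of a proof-structure $\mathcal S$ chooses, for each connective link with connective $\mathcal C$, a partition $p\in P_{\mathcal C}$ and exactly one element of each class of $p$. The correctness graph $\mathcal S_I$ is the multigraph on the nodes of $\mathcal S$ that has an edge between the conclusions of each axiom link, an edge between the premises of each cut link, and, for each connective link, an edge to its conclusion from each premise chosen by $I$. $\mathcal S$ is a \emph{proof-net} in the sense of the partition switching if $\mathcal S_I$ is connected and acyclic for every partition switching $I$. \textbf{Theorem} (sequentialization for generalized multiplicative connectives). Let $\mathcal S$ be an arbitrary proof-structure of $\mathsf{MLL}(\mathcal C_i)$. If $\mathcal S$ is a proof-net in the sense of the partition switching, then $\mathcal S$ is sequentializable. More generally, suppose that for each connective link $l$ of $\mathcal S$, with connective $\mathcal C$, one partition $p_l\in P_{\mathcal C}$ can be fixed such that $\mathcal S_I$ is connected and acyclic for every partition switching $I$ that selects one element from each class of these $p_l$; then $\mathcal S$ is sequentializable. -/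

import Mathlib

universe u

/-! ## Finite multigraphs -/

/-- A multigraph on the vertex type `V` with edge type `E`; the edge `e` joins `src e` and `tgt e`
(the graph is undirected, so the order of the two ends plays no role). -/
structure Multigraph (V E : Type*) where
  src : E → V
  tgt : E → V

namespace Multigraph

variable {V E : Type*}

/-- The barycentric subdivision: every edge is replaced by a new vertex joined to both its ends.
Parallel edges thus stay distinct. -/
def subdivision (G : Multigraph V E) : SimpleGraph (V ⊕ E) :=
  SimpleGraph.fromRel fun a b =>
    match a, b with
    | .inl v, .inr e => v = G.src e ∨ v = G.tgt e
    | _, _ => False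

/-- A multigraph is connected and acyclic: it has no loop, and its barycentric subdivision is
connected (in particular non-empty) and acyclic. Two parallel edges form a cycle. -/
def IsTree (G : Multigraph V E) : Prop :=
  (∀ e, G.src e ≠ G.tgt e) ∧ G.subdivision.IsTree

end Multigraph

/-! ## Partitions, meeting graphs, generalized connectives -/

/-- Partitions of an `n`-element set; the elements of `p.parts` are the classes of `p`. -/
abbrev NPartition (n : ℕ) : Type := Finpartition (Finset.univ : Finset (Fin n))

namespace NPartition

variable {n : ℕ}

/-- The class of `p` that contains `j`. -/
def classOf (p : NPartition n) (j : Fin n) : {c // c ∈ p.parts} :=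
  ⟨p.part j, p.part_mem.2 (Finset.mem_univ j)⟩

/-- The meeting graph of `p` and `q`: the upper vertices are the classes of `p`, the lower vertices
are the classes of `q`, and each number `j` is an edge from its class in `p` to its class in `q`. -/
def meetingGraph (p q : NPartition n) :
    Multigraph ({c // c ∈ p.parts} ⊕ {c // c ∈ q.parts}) (Fin n) where
  src j := .inl (classOf p j)
  tgt j := .inr (classOf q j)

/-- `p ⊥ q`: the meeting graph is connected and acyclic. -/
def Orthogonal (p q : NPartition n) : Prop := (meetingGraph p q).IsTree

/-- `P^⊥`: the set of all partitions that are orthogonal to every element of `P`. -/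
def orthogonalSet (P : Set (NPartition n)) : Set (NPartition n) :=
  {q | ∀ p ∈ P, Orthogonal p q}

end NPartition

/-- A pair `(C, C*)` of dual `n`-ary generalized connectives: two non-empty sets of partitions,
each of which is the orthogonal of the other. -/
structure ConnectivePair (n : ℕ) where
  pos : Set (NPartition n)
  neg : Set (NPartition n)
  pos_nonempty : pos.Nonempty
  neg_nonempty : neg.Nonempty
  orthogonal_pos : NPartition.orthogonalSet pos = neg
  orthogonal_neg : NPartition.orthogonalSet neg = pos

/-- A family `C_i` of generalized connectives, with arities `m_i` and duals `C_i*`. -/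
structure Signature (ι : Type u) where
  arity : ι → ℕ
  pair : (i : ι) → ConnectivePair (arity i)

/-- The connectives of `MLL(C_i)`: tensor, par, the `C_i` and their duals `C_i*`. -/
inductive Conn (ι : Type u) : Type u
  | tensor : Conn ι
  | par : Conn ι
  | gen (i : ι) : Conn ι
  | dual (i : ι) : Conn ι

section Logic

variable {ι : Type u} (σ : Signature ι)

/-- The number of arguments of a connective. -/
def Conn.arity : Conn ι → ℕ
  | .tensor => 2
  | .par => 2
  | .gen i => σ.arity i
  | .dual i => σ.arity i

/-- The partition set of a connective. Tensor has the single partition `{(1), (2)}` and par has the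
single partition `{(1, 2)}`. -/
def Conn.partitions : (c : Conn ι) → Set (NPartition (c.arity σ))
  | .tensor => {(⊥ : NPartition 2)}
  | .par => {(Finpartition.indiscrete (Finset.univ_nonempty (α := Fin 2)).ne_empty : NPartition 2)}
  | .gen i => (σ.pair i).pos
  | .dual i => (σ.pair i).neg

/-- Formulas of `MLL(C_i)`. `lit true k` is the propositional variable `P_k` and `lit false k` is
its negation. -/
inductive Formula : Type u
  | lit (b : Bool) (k : ℕ) : Formula
  | comp (c : Conn ι) (args : Fin (c.arity σ) → Formula) : Formula

variable {σ}

/-- The dual formula, by the De Morgan rules; `C_i` and `C_i*` are exchanged. -/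
def Formula.neg : Formula σ → Formula σ
  | .lit b k => .lit (!b) k
  | .comp .tensor args => .comp .par fun j => (args j).neg
  | .comp .par args => .comp .tensor fun j => (args j).neg
  | .comp (.gen i) args => .comp (.dual i) fun j => (args j).neg
  | .comp (.dual i) args => .comp (.gen i) fun j => (args j).neg

/-! ## Sequent calculus -/

variable (σ)

/-- Proofs of `MLL(C_i)`; sequents are finite multisets of formulas. The connective `c` has one
introduction rule for each partition `p` in its partition set, with one premise
`⊢ Γ_x, (A_j)_{j ∈ x}` for each class `x` of `p` and the conclusion `⊢ (Γ_x)_x, c(A_1, …, A_n)`.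
For tensor and par these are the usual rules. -/
inductive SeqProof : Multiset (Formula σ) → Type u
  | ax (k : ℕ) : SeqProof {.lit true k, .lit false k}
  | cut (A : Formula σ) (Γ Δ : Multiset (Formula σ))
      (π₁ : SeqProof (Γ + {A})) (π₂ : SeqProof (Δ + {A.neg})) : SeqProof (Γ + Δ)
  | intro (c : Conn ι) (p : NPartition (c.arity σ)) (hp : p ∈ c.partitions σ)
      (args : Fin (c.arity σ) → Formula σ)
      (Γ : {x // x ∈ p.parts} → Multiset (Formula σ))
      (π : ∀ x : {x // x ∈ p.parts}, SeqProof (Γ x + x.1.val.map args)) :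
      SeqProof (∑ x, Γ x + {.comp c args})

/-! ## Proof-structures -/

/-- The data of a proof-structure: occurrences of formulas (the nodes, with their labels), axiom
links with two conclusions, cut links with two premises, and links for the connectives, each with
its ordered premises and its conclusion. -/
structure LinkGraph where
  Node : Type
  Ax : Type
  Cut : Type
  CLink : Type
  label : Node → Formula σ
  axPos : Ax → Node
  axNeg : Ax → Node
  cutL : Cut → Node
  cutR : Cut → Node
  conn : CLink → Conn ι
  prem : (l : CLink) → Fin ((conn l).arity σ) → Node
  concl : CLink → Node

variable {σ}

namespace LinkGraph

/-- All positions of a premise in a link, with the node that stands there. -/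
def premiseAt (S : LinkGraph σ) :
    S.Cut ⊕ S.Cut ⊕ (Σ l : S.CLink, Fin ((S.conn l).arity σ)) → S.Node
  | .inl c => S.cutL c
  | .inr (.inl c) => S.cutR c
  | .inr (.inr x) => S.prem x.1 x.2

/-- All positions of a conclusion in a link, with the node that stands there. -/
def conclusionAt (S : LinkGraph σ) : S.Ax ⊕ S.Ax ⊕ S.CLink → S.Node
  | .inl a => S.axPos a
  | .inr (.inl a) => S.axNeg a
  | .inr (.inr l) => S.concl l

/-- A node is terminal if it is not a premise of any link. -/
def Terminal (S : LinkGraph σ) (v : S.Node) : Prop := ∀ x, S.premiseAt x ≠ v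

/-- Isomorphisms: bijections on nodes and links that respect the labels, the kinds of the links, and
their ordered premises and conclusions. -/
structure Iso (S T : LinkGraph σ) where
  node : S.Node ≃ T.Node
  ax : S.Ax ≃ T.Ax
  cut : S.Cut ≃ T.Cut
  clink : S.CLink ≃ T.CLink
  label_node : ∀ v, T.label (node v) = S.label v
  axPos_ax : ∀ a, T.axPos (ax a) = node (S.axPos a)
  axNeg_ax : ∀ a, T.axNeg (ax a) = node (S.axNeg a)
  cutL_cut : ∀ c, T.cutL (cut c) = node (S.cutL c)
  cutR_cut : ∀ c, T.cutR (cut c) = node (S.cutR c)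
  conn_clink : ∀ l, T.conn (clink l) = S.conn l
  prem_clink : ∀ l j, T.prem (clink l) j =
    node (S.prem l (Fin.cast (congrArg (Conn.arity σ) (conn_clink l)) j))
  concl_clink : ∀ l, T.concl (clink l) = node (S.concl l)

/-- The single axiom link with conclusions `P_k` and `∼P_k`. -/
def axiomLink (σ : Signature ι) (k : ℕ) : LinkGraph σ where
  Node := Bool
  Ax := Unit
  Cut := Empty
  CLink := Empty
  label b := .lit b k
  axPos _ := true
  axNeg _ := false
  cutL := Empty.elim
  cutR := Empty.elim
  conn := Empty.elim
  prem l := l.elim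
  concl := Empty.elim

/-- The disjoint union of `S` and `T` with one new cut link between the nodes `a` and `b`. -/
def addCut (S T : LinkGraph σ) (a : S.Node) (b : T.Node) : LinkGraph σ where
  Node := S.Node ⊕ T.Node
  Ax := S.Ax ⊕ T.Ax
  Cut := Option (S.Cut ⊕ T.Cut)
  CLink := S.CLink ⊕ T.CLink
  label := Sum.elim S.label T.label
  axPos := Sum.map S.axPos T.axPos
  axNeg := Sum.map S.axNeg T.axNeg
  cutL
    | none => .inl a
    | some c => Sum.map S.cutL T.cutL c
  cutR
    | none => .inr b
    | some c => Sum.map S.cutR T.cutR c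
  conn := Sum.elim S.conn T.conn
  prem
    | .inl l => fun j => .inl (S.prem l j)
    | .inr l => fun j => .inr (T.prem l j)
  concl := Sum.map S.concl T.concl

/-- The disjoint union of the `T x` with one new link for the connective `c`, whose premises are the
nodes `e j` and whose conclusion is a new node, labelled by `c` applied to the labels of the
premises. -/
def addConn {X : Type} (T : X → LinkGraph σ) (c : Conn ι)
    (e : Fin (c.arity σ) → Σ x, (T x).Node) : LinkGraph σ where
  Node := Option (Σ x, (T x).Node)
  Ax := Σ x, (T x).Ax
  Cut := Σ x, (T x).Cut
  CLink := Option (Σ x, (T x).CLink)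
  label
    | none => .comp c fun j => (T (e j).1).label (e j).2
    | some v => (T v.1).label v.2
  axPos a := some ⟨a.1, (T a.1).axPos a.2⟩
  axNeg a := some ⟨a.1, (T a.1).axNeg a.2⟩
  cutL d := some ⟨d.1, (T d.1).cutL d.2⟩
  cutR d := some ⟨d.1, (T d.1).cutR d.2⟩
  conn
    | none => c
    | some l => (T l.1).conn l.2
  prem
    | none => fun j => some (e j)
    | some l => fun j => some ⟨l.1, (T l.1).prem l.2 j⟩
  concl
    | none => none
    | some l => some ⟨l.1, (T l.1).concl l.2⟩

/-- `Translates π S`: the graph `S` is, up to isomorphism, the translation of the sequent proof `π`.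
Since sequents are multisets, a rule of `π` that acts on a formula with several occurrences in a
premise may act on any one of them. -/
inductive Translates : {Γ : Multiset (Formula σ)} → SeqProof σ Γ → LinkGraph σ → Prop
  | ax (k : ℕ) : Translates (.ax k) (axiomLink σ k)
  | cut {A : Formula σ} {Γ Δ : Multiset (Formula σ)}
      {π₁ : SeqProof σ (Γ + {A})} {π₂ : SeqProof σ (Δ + {A.neg})} {S T : LinkGraph σ}
      (hS : Translates π₁ S) (hT : Translates π₂ T)
      (a : S.Node) (b : T.Node) (ha : S.Terminal a) (hb : T.Terminal b)
      (hA : S.label a = A) (hB : T.label b = A.neg) :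
      Translates (.cut A Γ Δ π₁ π₂) (addCut S T a b)
  | intro {c : Conn ι} {p : NPartition (c.arity σ)} {hp : p ∈ c.partitions σ}
      {args : Fin (c.arity σ) → Formula σ}
      {Γ : {x // x ∈ p.parts} → Multiset (Formula σ)}
      {π : ∀ x : {x // x ∈ p.parts}, SeqProof σ (Γ x + x.1.val.map args)}
      {T : {x // x ∈ p.parts} → LinkGraph σ}
      (hT : ∀ x, Translates (π x) (T x))
      (e : Fin (c.arity σ) → Σ x, (T x).Node) (he : Function.Injective e)
      (hclass : ∀ j, j ∈ (e j).1.1)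
      (hterm : ∀ j, (T (e j).1).Terminal (e j).2)
      (hlabel : ∀ j, (T (e j).1).label (e j).2 = args j) :
      Translates (.intro c p hp args Γ π) (addConn T c e)
  | iso {Γ : Multiset (Formula σ)} {π : SeqProof σ Γ} {S T : LinkGraph σ}
      (hS : Translates π S) (f : Iso S T) : Translates π T

/-- `S` is the translation of some sequent proof of `MLL(C_i)`. -/
def Sequentializable (S : LinkGraph σ) : Prop :=
  ∃ (Γ : Multiset (Formula σ)) (π : SeqProof σ Γ), Translates π S

/-- A partition switching: for each link a partition in the partition set of its connective, and a
set of premises that has exactly one element in each class of that partition. -/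
structure PartitionSwitching (S : LinkGraph σ) where
  part : (l : S.CLink) → NPartition ((S.conn l).arity σ)
  part_mem : ∀ l, part l ∈ (S.conn l).partitions σ
  chosen : (l : S.CLink) → Set (Fin ((S.conn l).arity σ))
  chosen_spec : ∀ l, ∀ x ∈ (part l).parts, ∃! j, j ∈ x ∧ j ∈ chosen l

/-- The correctness graph `S_I`: the vertices are the nodes of `S`; each axiom link is an edge
between its conclusions, each cut link is an edge between its premises, and each premise of a
connective link that is chosen by `I` is joined by an edge to the conclusion of the link. -/
def correctnessGraph (S : LinkGraph σ) (I : S.PartitionSwitching) :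
    Multigraph S.Node (S.Ax ⊕ S.Cut ⊕ (Σ l : S.CLink, {j // j ∈ I.chosen l})) where
  src
    | .inl a => S.axPos a
    | .inr (.inl c) => S.cutL c
    | .inr (.inr x) => S.prem x.1 x.2.1
  tgt
    | .inl a => S.axNeg a
    | .inr (.inl c) => S.cutR c
    | .inr (.inr x) => S.concl x.1

end LinkGraph

variable (σ)

/-- Proof-structures of `MLL(C_i)`: non-empty and finite, correctly labelled, every formula
occurrence being the conclusion of exactly one link and a premise of at most one. -/
structure ProofStructure extends LinkGraph σ where
  nonempty : Nonempty Node
  finite : Finite Node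
  label_ax : ∀ a, ∃ k, label (axPos a) = .lit true k ∧ label (axNeg a) = .lit false k
  label_cut : ∀ c, label (cutR c) = (label (cutL c)).neg
  label_conn : ∀ l, label (concl l) = .comp (conn l) fun j => label (prem l j)
  conclusion_bijective : Function.Bijective toLinkGraph.conclusionAt
  premise_injective : Function.Injective toLinkGraph.premiseAt

variable {σ}

/-- A proof-net in the sense of the partition switching: the correctness graph of every partition
switching is connected and acyclic. -/
def ProofStructure.IsProofNet (S : ProofStructure σ) : Prop :=
  ∀ I : S.PartitionSwitching, (S.correctnessGraph I).IsTree

/-- The same for one fixed choice `p` of a partition for each link: the correctness graph of every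
partition switching that selects from the classes of `p` is connected and acyclic. -/
def ProofStructure.IsProofNetFor (S : ProofStructure σ)
    (p : (l : S.CLink) → NPartition ((S.conn l).arity σ)) : Prop :=
  ∀ I : S.PartitionSwitching, I.part = p → (S.correctnessGraph I).IsTree

end Logic

/-! Fix one partition for each link. Each of its classes becomes a cluster of alternative edges
attached to the conclusion of the link. An axiom link is a cluster with one edge, and a cut link
becomes a vertex with two such clusters. The hypothesis then says that every choice of one edge per
cluster gives a tree. `IsCorrect` phrases this with two-valued functions: a function constant along
all chosen edges is constant, and for each edge some function is constant along all the others but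
separates its ends. Such functions are easily transported along a quotient, so correctness survives
the contraction of chosen edges (`IsCorrect.contract`).

The combinatorial core is `IsCorrect.exists_subsingleton_src`: the clusters cannot all have two
sources. Otherwise mark two sources in every cluster and contract one marked edge. By induction
another cluster collapses to a single source, so its two marked sources were the ends of the
contracted edge. Edges of different clusters are never parallel, so this sends the `2|R|` marked
edges injectively to the `|R|` clusters, which is absurd. `IsCorrect.exists_ready` strengthens this:
some unprocessed vertex has only clusters with a single source, each a processed vertex.

Sequentialization is then parsing from the axioms downwards. A stage is a quotient whose processed
vertices are parts already translated from proofs (`ParseState`). A ready vertex is a link for which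
the premises of each class lie in one finished part. Different classes lie in different parts, since
otherwise two edges would be parallel. This is exactly the situation of a connective rule or a cut,
so the new part is again a translation, and contracting it gives the next stage. When no link is
left, connectedness leaves a single part, which is the whole structure. -/

/-! ## Clusters of alternative edges -/

section Clusters

variable {K W : Type*}

/-- Each `κ ∈ R` is a cluster of alternative edges, joining the vertex `t κ` to the elements of
`src κ`. Whenever one edge is kept from each cluster, the resulting graph on the vertex set `A` is
connected, and each of its edges is a bridge. Both properties are expressed by two-valued
functions on the vertices. -/
structure IsCorrect (A : Set W) (R : Set K) (t : K → W) (src : K → Set W) : Prop where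
  tgt_mem : ∀ κ ∈ R, t κ ∈ A
  src_subset : ∀ κ ∈ R, src κ ⊆ A
  src_nonempty : ∀ κ ∈ R, (src κ).Nonempty
  connected : ∀ φ : K → W, (∀ κ ∈ R, φ κ ∈ src κ) → ∀ g : W → Prop,
    (∀ κ ∈ R, (g (t κ) ↔ g (φ κ))) → ∀ x ∈ A, ∀ y ∈ A, (g x ↔ g y)
  bridge : ∀ φ : K → W, (∀ κ ∈ R, φ κ ∈ src κ) → ∀ κ ∈ R, ∃ g : W → Prop,
    (∀ κ' ∈ R, κ' ≠ κ → (g (t κ') ↔ g (φ κ'))) ∧ ¬ (g (t κ) ↔ g (φ κ))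

namespace IsCorrect

variable {A : Set W} {R : Set K} {t : K → W} {src : K → Set W}

/-- Clusters are chosen from independently, so a choice prescribed on some of them extends to all;
the value outside `D` and `R` is a mere filler. -/
theorem exists_choice (h : IsCorrect A R t src) (s : K → W) (D : Set K)
    (hs : ∀ κ ∈ D, s κ ∈ src κ) :
    ∃ φ : K → W, (∀ κ ∈ R, φ κ ∈ src κ) ∧ ∀ κ ∈ D, φ κ = s κ := by
  classical
  refine ⟨fun κ => if κ ∈ D then s κ else
    if hκ : κ ∈ R then (h.src_nonempty κ hκ).some else s κ, fun κ hκ => ?_, fun κ hκ => ?_⟩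
  · by_cases hD : κ ∈ D
    · simpa [hD] using hs κ hD
    · simpa [hD, hκ] using (h.src_nonempty κ hκ).some_mem
  · simp [hκ]

theorem tgt_notMem_src (h : IsCorrect A R t src) {κ : K} (hκ : κ ∈ R) : t κ ∉ src κ := by
  intro hmem
  obtain ⟨φ, hφ, hφκ⟩ := h.exists_choice (fun _ => t κ) {κ} (by rintro _ rfl; exact hmem)
  obtain ⟨g, -, hg⟩ := h.bridge φ hφ κ hκ
  exact hg (by rw [hφκ κ rfl])

/-- Two parallel edges from different clusters can be chosen together. They form a cycle, so neither
is a bridge. -/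
theorem not_parallel (h : IsCorrect A R t src) {κ μ : K} (hκ : κ ∈ R) (hμ : μ ∈ R)
    (hne : κ ≠ μ) {a b : W} (ha : a ∈ src κ) (hb : b ∈ src μ) :
    ¬ ((t κ = t μ ∧ a = b) ∨ (t κ = b ∧ a = t μ)) := by
  classical
  intro hpar
  obtain ⟨φ, hφ, hφκ⟩ := h.exists_choice (fun x => if x = κ then a else b) {κ, μ} (by
    rintro x (rfl | rfl)
    · simpa using ha
    · simpa [hne.symm] using hb)
  obtain ⟨g, hg, hgκ⟩ := h.bridge φ hφ κ hκ
  have h1 : φ κ = a := by rw [hφκ κ (by simp)]; simp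
  have h2 : φ μ = b := by rw [hφκ μ (by simp)]; simp [hne.symm]
  have h3 := hg μ hμ hne.symm
  rw [h2] at h3
  rw [h1] at hgκ
  rcases hpar with ⟨e1, e2⟩ | ⟨e1, e2⟩
  · rw [e1, e2] at hgκ
    exact hgκ h3
  · rw [e1, e2] at hgκ
    exact hgκ h3.symm

/-! ### Contraction of chosen edges -/

/-- Contracting one edge of each cluster in `D` preserves correctness. -/
theorem contract (h : IsCorrect A R t src) (D : Set K) (m : W → W) (s : K → W)
    (hs : ∀ κ ∈ D, s κ ∈ src κ) (hm : ∀ κ ∈ D, m (t κ) = m (s κ))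
    (hg : ∀ g : W → Prop, (∀ κ ∈ D ∩ R, (g (t κ) ↔ g (s κ))) → ∀ v, (g (m v) ↔ g v)) :
    IsCorrect (m '' A) (R \ D) (m ∘ t) (fun κ => m '' src κ) := by
  -- A choice in the quotient lifts to a choice upstairs that takes the contracted edge `s κ` in
  -- each cluster of `D`.
  have key : ∀ φ : K → W, (∀ κ ∈ R \ D, φ κ ∈ m '' src κ) →
      ∃ ψ : K → W, (∀ κ ∈ R, ψ κ ∈ src κ) ∧ (∀ κ ∈ D, ψ κ = s κ) ∧
        ∀ κ ∈ R \ D, m (ψ κ) = φ κ := by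
    classical
    intro φ hφ
    have hφ' : ∀ κ, ∃ w, κ ∈ R \ D → w ∈ src κ ∧ m w = φ κ := fun κ => by
      by_cases hκ : κ ∈ R \ D
      · exact (hφ κ hκ).imp fun w hw _ => hw
      · exact ⟨φ κ, fun h' => absurd h' hκ⟩
    choose q hq using hφ'
    refine ⟨fun κ => if κ ∈ D then s κ else q κ, fun κ hκ => ?_, fun κ hκ => if_pos hκ,
      fun κ hκ => ?_⟩
    · by_cases hD : κ ∈ D
      · simpa [hD] using hs κ hD
      · simpa [hD] using (hq κ ⟨hκ, hD⟩).1
    · simpa [hκ.2] using (hq κ hκ).2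
  refine ⟨fun κ hκ => ⟨_, h.tgt_mem κ hκ.1, rfl⟩,
    fun κ hκ => Set.image_mono (h.src_subset κ hκ.1),
    fun κ hκ => (h.src_nonempty κ hκ.1).image m, ?_, ?_⟩
  · rintro φ hφ g hgφ _ ⟨x, hx, rfl⟩ _ ⟨y, hy, rfl⟩
    obtain ⟨ψ, hψ, hψD, hψm⟩ := key φ hφ
    refine h.connected ψ hψ (fun v => g (m v)) (fun κ hκ => ?_) x hx y hy
    by_cases hD : κ ∈ D
    · simp only [hψD κ hD, hm κ hD]
    · have hgκ := hgφ κ ⟨hκ, hD⟩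
      rwa [← hψm κ ⟨hκ, hD⟩] at hgκ
  · intro φ hφ κ hκ
    obtain ⟨ψ, hψ, hψD, hψm⟩ := key φ hφ
    obtain ⟨g, hg1, hg2⟩ := h.bridge ψ hψ κ hκ.1
    -- The cluster under test is not in `D`, so the separating function is constant along the
    -- contracted edges and hence descends to the quotient.
    have hgm := hg g fun κ' hκ' => by
      rw [← hψD κ' hκ'.1]
      exact hg1 κ' hκ'.2 (by rintro rfl; exact hκ.2 hκ'.1)
    refine ⟨g, fun κ' hκ' hne => ?_, ?_⟩
    · rw [Function.comp_apply, hgm, ← hψm κ' hκ', hgm]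
      exact hg1 κ' hκ'.1 hne
    · rw [Function.comp_apply, hgm, ← hψm κ hκ, hgm]
      exact hg2

-- The target of the cluster is moved onto the chosen source. The two differ because correctness
-- excludes loops.
open Classical in
theorem contract_edge (h : IsCorrect A R t src) {κ : K} (hκ : κ ∈ R) {a : W} (ha : a ∈ src κ) :
    IsCorrect (Function.update id (t κ) a '' A) (R \ {κ}) (Function.update id (t κ) a ∘ t)
      (fun κ' => Function.update id (t κ) a '' src κ') := by
  have hne : a ≠ t κ := by rintro rfl; exact h.tgt_notMem_src hκ ha
  refine h.contract {κ} _ (fun _ => a) (by rintro _ rfl; exact ha) ?_ ?_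
  · rintro _ rfl
    simp [Function.update_of_ne hne]
  · intro g hg v
    by_cases hv : v = t κ
    · subst hv
      simpa using (hg κ ⟨rfl, hκ⟩).symm
    · simp [Function.update_of_ne hv]

/-- Contracting an edge merges its two ends and nothing else. -/
theorem _root_.update_id_eq [DecidableEq W] {x y a b : W}
    (h : Function.update id a b x = Function.update id a b y) (hxy : x ≠ y) :
    (x = a ∧ y = b) ∨ (x = b ∧ y = a) := by
  simp only [Function.update_apply, id] at h
  split_ifs at h with h1 h2 h2
  · exact absurd (h1.trans h2.symm) hxy
  · exact Or.inl ⟨h1, h.symm⟩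
  · exact Or.inr ⟨h, h2⟩
  · exact absurd h hxy

theorem subsingleton_of_empty (h : IsCorrect A R t src) (hR : R = ∅) : A.Subsingleton := by
  subst hR
  intro x hx y hy
  exact ((h.connected t (by simp) (· = x) (by simp) x hx y hy).1 rfl).symm

/-! ### Existence of clusters that can be processed -/

/-- If there is a cluster at all, then some cluster consists of parallel edges. -/
theorem exists_subsingleton_src [Finite K] (h : IsCorrect A R t src) (hR : R.Nonempty) :
    ∃ κ ∈ R, (src κ).Subsingleton := by
  classical
  induction hn : R.ncard using Nat.strong_induction_on generalizing A R t src with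
  | _ n ih =>
  by_contra! hcon
  have hpair : ∀ κ ∈ R, ∃ s : Bool → W, (∀ i, s i ∈ src κ) ∧ s true ≠ s false := by
    intro κ hκ
    obtain ⟨a, ha, b, hb, hab⟩ := hcon κ hκ
    exact ⟨fun i => if i then a else b, by rintro (_ | _) <;> simp [ha, hb], by simpa using hab⟩
  have : Nonempty W := ⟨t hR.some⟩
  choose! s hs hsne using hpair
  -- After contraction of the edge from `t κ` to `s κ i`, some cluster `κ'` has its two marked
  -- sources merged, so they are the two ends of that edge.
  have hedge : ∀ κ ∈ R, ∀ i : Bool, ∃ κ' ∈ R,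
      (s κ' true = t κ ∧ s κ' false = s κ i) ∨ (s κ' true = s κ i ∧ s κ' false = t κ) := by
    intro κ hκ i
    have hc := h.contract_edge hκ (hs κ hκ i)
    rcases (R \ {κ}).eq_empty_or_nonempty with he | hne
    -- With no cluster left the quotient is a point. The two marked sources of `κ` itself are then
    -- merged, which would make one of them equal to `t κ`.
    · have hsub := hc.subsingleton_of_empty he
      have := hsub ⟨_, h.src_subset κ hκ (hs κ hκ true), rfl⟩
        ⟨_, h.src_subset κ hκ (hs κ hκ false), rfl⟩
      have hnt : ∀ j, s κ j ≠ t κ := fun j e => h.tgt_notMem_src hκ (e ▸ hs κ hκ j)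
      rcases update_id_eq this (hsne κ hκ) with ⟨e, -⟩ | ⟨-, e⟩
      · exact absurd e (hnt _)
      · exact absurd e (hnt _)
    · have hlt : (R \ {κ}).ncard < n := by
        rw [← hn]
        exact Set.ncard_sdiff_singleton_lt_of_mem hκ
      obtain ⟨κ', hκ', hsub⟩ := ih _ hlt hc hne rfl
      exact ⟨κ', hκ'.1, update_id_eq (hsub ⟨_, hs κ' hκ'.1 true, rfl⟩ ⟨_, hs κ' hκ'.1 false, rfl⟩)
        (hsne κ' hκ'.1)⟩
  choose f hfR hf using hedge
  -- The pair of marked sources of `κ'` determines the ends of the contracted edge. Marked edges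
  -- with the same image are thus parallel, so they belong to one cluster and are equal.
  have hinj : Function.Injective
      (fun x : R × Bool => (⟨f x.1 x.1.2 x.2, hfR x.1 x.1.2 x.2⟩ : R)) := by
    rintro ⟨⟨κ, hκ⟩, i⟩ ⟨⟨μ, hμ⟩, j⟩ he
    have he' : f κ hκ i = f μ hμ j := congrArg Subtype.val he
    have h1 := hf κ hκ i
    have h2 := hf μ hμ j
    rw [← he'] at h2
    have hpar : (t κ = t μ ∧ s κ i = s μ j) ∨ (t κ = s μ j ∧ s κ i = t μ) := by
      rcases h1 with ⟨e1, e2⟩ | ⟨e1, e2⟩ <;> rcases h2 with ⟨e3, e4⟩ | ⟨e3, e4⟩ <;>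
        rw [e1] at e3 <;> rw [e2] at e4 <;> simp [e3, e4]
    have hκμ : κ = μ := by
      by_contra hne
      exact h.not_parallel hκ hμ hne (hs κ hκ i) (hs μ hμ j) hpar
    subst hκμ
    rcases hpar with ⟨-, e⟩ | ⟨e, -⟩
    · have : i = j := by
        have h3 := hsne κ hκ
        cases i <;> cases j <;> first | rfl | exact absurd e h3 | exact absurd e.symm h3
      rw [this]
    · exact absurd (e ▸ hs κ hκ j) (h.tgt_notMem_src hκ)
  have hcard : Nat.card (R × Bool) ≤ Nat.card R := Nat.card_le_card_of_injective _ hinj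
  rw [Nat.card_prod, Nat.card_eq_fintype_card (α := Bool), Fintype.card_bool] at hcard
  have : Nonempty R := hR.to_subtype
  have := Nat.card_pos (α := R)
  omega

/-- Let `U` be a non-empty set of vertices that contains the targets of all clusters. Then for some
`u ∈ U`, every cluster with target `u` joins it to a single vertex outside of `U`. -/
theorem exists_ready [Finite K] (h : IsCorrect A R t src) (U : Set W) (hU : U.Nonempty)
    (ht : ∀ κ ∈ R, t κ ∈ U) :
    ∃ u ∈ U, ∀ κ ∈ R, t κ = u → ∃ b ∉ U, src κ = {b} := by
  classical
  induction hn : R.ncard using Nat.strong_induction_on generalizing A R t src U with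
  | _ n ih =>
  by_contra! hcon
  obtain ⟨u₀, hu₀⟩ := hU
  -- A vertex without clusters would be ready, so there is at least one cluster and one with a
  -- single source can be found.
  obtain ⟨κ₀, hκ₀, -⟩ := hcon u₀ hu₀
  obtain ⟨κ, hκ, hsub⟩ := h.exists_subsingleton_src ⟨κ₀, hκ₀⟩
  obtain ⟨a, ha⟩ := h.src_nonempty κ hκ
  have hsrc : src κ = {a} := hsub.eq_singleton_of_mem ha
  set m := Function.update id (t κ) a with hm
  have hne : a ≠ t κ := by rintro rfl; exact h.tgt_notMem_src hκ ha
  have hc := h.contract_edge hκ ha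
  have hlt : (R \ {κ}).ncard < n := by
    rw [← hn]
    exact Set.ncard_sdiff_singleton_lt_of_mem hκ
  obtain ⟨_, ⟨u, hu, rfl⟩, hready⟩ := ih _ hlt hc (m '' U) ⟨_, u₀, hu₀, rfl⟩
    (fun κ' hκ' => ⟨_, ht κ' hκ'.1, rfl⟩) rfl
  -- every vertex of `U` has a cluster other than `κ`, or shares its image with one that has
  have hother : ∃ v ∈ U, m v = m u ∧ ∃ κ' ∈ R \ {κ}, t κ' = v ∧ ∀ b ∉ U, src κ' ≠ {b} := by
    obtain ⟨κ', hκ', htu, hbad⟩ := hcon u hu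
    by_cases hk : κ' = κ
    -- If the obstruction at `u` is the contracted cluster, its source `a` must lie in `U`. The
    -- obstruction at `a` is then a different cluster, and `a` has the same image as `u`.
    · subst hk
      have haU : a ∈ U := by
        by_contra haU
        exact hbad a haU hsrc
      obtain ⟨μ, hμ, hta, hbad'⟩ := hcon a haU
      refine ⟨a, haU, ?_, μ, ⟨hμ, ?_⟩, hta, hbad'⟩
      · rw [← htu, hm]
        simp [Function.update_of_ne hne]
      · rintro rfl
        exact hne hta.symm
    · exact ⟨u, hu, rfl, κ', ⟨hκ', hk⟩, htu, hbad⟩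
  obtain ⟨v, hv, hvu, κ', hκ', htv, hbad⟩ := hother
  obtain ⟨b, hb, hsb⟩ := hready κ' hκ' (by rw [Function.comp_apply, htv]; exact hvu)
  -- The image of the source set of `κ'` is a single vertex outside `m '' U`. Its sources therefore
  -- lie outside `U`, and merging two of them would involve `t κ`, which lies in `U`.
  have hnU : ∀ x ∈ src κ', x ∉ U := by
    intro x hx hxU
    have : m x ∈ m '' src κ' := ⟨x, hx, rfl⟩
    rw [hsb] at this
    exact hb (this ▸ ⟨x, hxU, rfl⟩)
  obtain ⟨x, hx⟩ := h.src_nonempty κ' hκ'.1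
  refine hbad x (hnU x hx) (Set.eq_singleton_iff_unique_mem.2 ⟨hx, fun y hy => ?_⟩)
  by_contra hyx
  have hmm : m y = m x := by
    have h1 : m x ∈ m '' src κ' := ⟨x, hx, rfl⟩
    have h2 : m y ∈ m '' src κ' := ⟨y, hy, rfl⟩
    rw [hsb] at h1 h2
    exact h2.trans h1.symm
  rcases update_id_eq hmm hyx with ⟨e, -⟩ | ⟨-, e⟩
  · exact hnU y hy (e ▸ ht κ hκ)
  · exact hnU x hx (e ▸ ht κ hκ)

end IsCorrect

end Clusters

/-! ## Trees by two-valued functions -/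

namespace Multigraph

variable {V E : Type*} {G : Multigraph V E}

/-- Each subdivision vertex gets the value of the ends of its edge; the extended function is
constant along walks. -/
theorem IsTree.iff_of_invariant (h : G.IsTree) (g : V → Prop)
    (hg : ∀ e, (g (G.src e) ↔ g (G.tgt e))) (x y : V) : g x ↔ g y := by
  let g' : V ⊕ E → Prop := Sum.elim g fun e => g (G.src e)
  have hadj : ∀ a b, G.subdivision.Adj a b → (g' a ↔ g' b) := by
    intro a b hab
    simp only [subdivision, SimpleGraph.fromRel_adj] at hab
    rcases a with v | e <;> rcases b with w | f <;> simp only [or_false, false_or] at hab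
    · exact absurd hab.2 id
    · rcases hab.2 with rfl | rfl
      · exact Iff.rfl
      · exact (hg f).symm
    · rcases hab.2 with rfl | rfl
      · exact Iff.rfl
      · exact hg e
    · exact absurd hab.2 id
  obtain ⟨p⟩ := h.2.connected.preconnected (.inl x) (.inl y)
  have : ∀ a b, G.subdivision.Walk a b → (g' a ↔ g' b) := by
    intro a b p
    induction p with
    | nil => exact Iff.rfl
    | cons hab _ ih => exact (hadj _ _ hab).trans ih
  exact this _ _ p

theorem subdivision_adj_src (G : Multigraph V E) (e : E) :
    G.subdivision.Adj (.inl (G.src e)) (.inr e) := by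
  simp [subdivision]

theorem subdivision_adj_tgt (G : Multigraph V E) (e : E) :
    G.subdivision.Adj (.inl (G.tgt e)) (.inr e) := by
  simp [subdivision]

/-- Deleting the half-edge from the source of `e` to its midpoint disconnects the subdivision, and
reachability from that source is the separating function. -/
theorem IsTree.exists_bridge (h : G.IsTree) (e : E) :
    ∃ g : V → Prop, (∀ e' ≠ e, (g (G.src e') ↔ g (G.tgt e'))) ∧
      ¬ (g (G.src e) ↔ g (G.tgt e)) := by
  set H := G.subdivision.deleteEdges {s(.inl (G.src e), .inr e)} with hH
  have hb := SimpleGraph.isAcyclic_iff_forall_adj_isBridge.1 h.2.isAcyclic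
    (G.subdivision_adj_src e)
  rw [SimpleGraph.isBridge_iff] at hb
  refine ⟨fun v => H.Reachable (.inl (G.src e)) (.inl v), fun e' he' => ?_, fun hiff => ?_⟩
  · have h1 : H.Adj (.inl (G.src e')) (.inr e') := by
      simp [hH, G.subdivision_adj_src e', he']
    have h2 : H.Adj (.inl (G.tgt e')) (.inr e') := by
      simp [hH, G.subdivision_adj_tgt e', he']
    have h3 := h1.reachable.trans h2.reachable.symm
    exact ⟨fun h => h.trans h3, fun h => h.trans h3.symm⟩
  -- The other half of `e` survives the deletion because `e` is not a loop.
  · have h2 : H.Adj (.inl (G.tgt e)) (.inr e) := by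
      simp [hH, G.subdivision_adj_tgt e, (h.1 e).symm]
    exact hb ((hiff.1 (SimpleGraph.Reachable.refl _)).trans h2.reachable)

end Multigraph

/-! ## The clusters of a proof-structure -/

namespace LinkGraph

variable {ι : Type u} {σ : Signature ι} (S : LinkGraph σ)
  (p : (l : S.CLink) → NPartition ((S.conn l).arity σ))

/-- The clusters for a fixed choice `p` of partitions: the axiom links, the two ends of each cut
link, and the classes of the partition of each connective link. -/
abbrev Cluster : Type := S.Ax ⊕ (S.Cut × Bool) ⊕ (Σ l : S.CLink, {x // x ∈ (p l).parts})

/-- The vertex at which a cluster is attached. A cut link counts as a vertex. -/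
def clusterTgt : S.Cluster p → S.Node ⊕ S.Cut
  | .inl a => .inl (S.axPos a)
  | .inr (.inl c) => .inr c.1
  | .inr (.inr x) => .inl (S.concl x.1)

/-- The alternative other ends of the edge of a cluster. -/
def clusterSrc : S.Cluster p → Set (S.Node ⊕ S.Cut)
  | .inl a => {.inl (S.axNeg a)}
  | .inr (.inl (c, true)) => {.inl (S.cutL c)}
  | .inr (.inl (c, false)) => {.inl (S.cutR c)}
  | .inr (.inr x) => (fun j => .inl (S.prem x.1 j)) '' (x.2.1 : Set (Fin ((S.conn x.1).arity σ)))

variable {S p}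

/-- The switching that selects the edges given by `φ`. -/
def switchingOf (hp : ∀ l, p l ∈ (S.conn l).partitions σ)
    (hinj : ∀ l, Function.Injective (S.prem l)) (φ : S.Cluster p → S.Node ⊕ S.Cut)
    (hφ : ∀ κ, φ κ ∈ S.clusterSrc p κ) : S.PartitionSwitching where
  part := p
  part_mem := hp
  -- A premise is selected when `φ` sends its own class to it. Injectivity of the premises makes it
  -- the only one in the class.
  chosen l := {j | φ (.inr (.inr ⟨l, NPartition.classOf (p l) j⟩)) = .inl (S.prem l j)}
  chosen_spec l x hx := by
    have hclass : ∀ j ∈ x, NPartition.classOf (p l) j = ⟨x, hx⟩ := fun j hj =>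
      Subtype.ext ((p l).part_eq_of_mem hx hj)
    obtain ⟨j, hj, hjφ⟩ := hφ (.inr (.inr ⟨l, x, hx⟩))
    refine ⟨j, ⟨hj, ?_⟩, ?_⟩
    · simp only [Set.mem_ofPred_eq, hclass j hj]
      exact hjφ.symm
    · rintro k ⟨hk, hkφ⟩
      simp only [Set.mem_ofPred_eq, hclass k hk] at hkφ
      rw [← hjφ] at hkφ
      exact (hinj l (Sum.inl_injective hkφ)).symm

theorem eq_of_mem_clusterSrc {φ : S.Cluster p → S.Node ⊕ S.Cut}
    (hφ : ∀ κ, φ κ ∈ S.clusterSrc p κ) :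
    (∀ a, φ (.inl a) = .inl (S.axNeg a)) ∧ (∀ c, φ (.inr (.inl (c, true))) = .inl (S.cutL c)) ∧
      ∀ c, φ (.inr (.inl (c, false))) = .inl (S.cutR c) :=
  ⟨fun a => by simpa [clusterSrc] using hφ (.inl a),
    fun c => by simpa [clusterSrc] using hφ (.inr (.inl (c, true))),
    fun c => by simpa [clusterSrc] using hφ (.inr (.inl (c, false)))⟩

/-- A choice of edges is a switching for `p`, and its graph is the correctness graph with every cut
edge subdivided. Functions on the nodes only have to be extended to the cut vertices. -/
theorem isCorrect_cluster (hp : ∀ l, p l ∈ (S.conn l).partitions σ)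
    (hinj : ∀ l, Function.Injective (S.prem l))
    (htree : ∀ I : S.PartitionSwitching, I.part = p → (S.correctnessGraph I).IsTree) :
    IsCorrect Set.univ Set.univ (S.clusterTgt p) (S.clusterSrc p) := by
  classical
  refine ⟨fun _ _ => trivial, fun _ _ => Set.subset_univ _, ?_, ?_, ?_⟩
  · rintro (a | ⟨c, (_ | _)⟩ | ⟨l, x, hx⟩) -
    · exact Set.singleton_nonempty _
    · exact Set.singleton_nonempty _
    · exact Set.singleton_nonempty _
    · exact Set.Nonempty.image _ ((p l).nonempty_of_mem_parts hx)
  · intro φ hφ g hg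
    have hφ' := fun κ => hφ κ trivial
    set I := switchingOf hp hinj φ hφ'
    obtain ⟨hax, htrue, hfalse⟩ := eq_of_mem_clusterSrc hφ'
    have hL : ∀ c, g (.inr c) ↔ g (.inl (S.cutL c)) := fun c => by
      have h1 := hg (.inr (.inl (c, true))) trivial
      rwa [htrue c] at h1
    have hR : ∀ c, g (.inr c) ↔ g (.inl (S.cutR c)) := fun c => by
      have h1 := hg (.inr (.inl (c, false))) trivial
      rwa [hfalse c] at h1
    have hnode := (htree I rfl).iff_of_invariant (fun v => g (.inl v)) (by
      rintro (a | c | ⟨l, j, hj⟩)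
      · have h1 := hg (.inl a) trivial
        rwa [hax a] at h1
      · exact (hL c).symm.trans (hR c)
      · have h1 := hg (.inr (.inr ⟨l, NPartition.classOf (p l) j⟩)) trivial
        rw [show φ (.inr (.inr ⟨l, NPartition.classOf (p l) j⟩)) = _ from hj] at h1
        exact h1.symm)
    rintro (v | c) - (w | d) -
    · exact hnode v w
    · exact (hnode _ _).trans (hL d).symm
    · exact (hL c).trans (hnode _ _)
    · exact (hL c).trans ((hnode _ _).trans (hL d).symm)
  · intro φ hφ
    have hφ' := fun κ => hφ κ trivial
    set I := switchingOf hp hinj φ hφ'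
    obtain ⟨hax, htrue, hfalse⟩ := eq_of_mem_clusterSrc hφ'
    have hlink : ∀ l x, ∃ j : {j // j ∈ I.chosen l}, NPartition.classOf (p l) j.1 = x ∧
        φ (.inr (.inr ⟨l, x⟩)) = .inl (S.prem l j.1) := by
      rintro l ⟨x, hx⟩
      obtain ⟨j, ⟨hjx, hj⟩, -⟩ := I.chosen_spec l x hx
      have hjx' : NPartition.classOf (p l) j = ⟨x, hx⟩ :=
        Subtype.ext ((p l).part_eq_of_mem hx hjx)
      refine ⟨⟨j, hj⟩, hjx', ?_⟩
      rw [← hjx']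
      exact hj
    rintro (a | ⟨c, b⟩ | ⟨l, x⟩) -
    · obtain ⟨g, hg, hge⟩ := (htree I rfl).exists_bridge (.inl a)
      refine ⟨Sum.elim g fun c => g (S.cutL c), ?_, ?_⟩
      · rintro (a' | ⟨c', (_ | _)⟩ | ⟨l', x'⟩) - hne
        · simpa [hax, clusterTgt, correctnessGraph] using hg (.inl a') (by simpa using hne)
        · simpa [hfalse, clusterTgt, correctnessGraph] using hg (.inr (.inl c')) (by simp)
        · simp [htrue, clusterTgt]
        · obtain ⟨j, hj, hφj⟩ := hlink l' x'
          simpa [hφj, clusterTgt, correctnessGraph] using (hg (.inr (.inr ⟨l', j⟩)) (by simp)).symm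
      · simpa [hax, clusterTgt, correctnessGraph] using hge
    · obtain ⟨g, hg, hge⟩ := (htree I rfl).exists_bridge (.inr (.inl c))
      have hge' : ¬ (g (S.cutL c) ↔ g (S.cutR c)) := hge
      -- The cut vertex `c` takes the value of the premise at its other end, so the break between
      -- the two premises falls exactly on the end `b` under test.
      refine ⟨Sum.elim g fun c' => if c' = c ∧ b = true then g (S.cutR c') else g (S.cutL c'),
        ?_, ?_⟩
      · rintro (a' | ⟨c', b'⟩ | ⟨l', x'⟩) - hne
        · simpa [hax, clusterTgt, correctnessGraph] using hg (.inl a') (by simp)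
        · by_cases hc : c' = c
          · subst hc
            cases b <;> cases b' <;> simp [htrue, hfalse, clusterTgt] at hne ⊢
          · cases b'
            · simpa [hfalse, clusterTgt, correctnessGraph, hc] using hg (.inr (.inl c')) (by simpa using hc)
            · simp [htrue, clusterTgt, hc]
        · obtain ⟨j, hj, hφj⟩ := hlink l' x'
          simpa [hφj, clusterTgt, correctnessGraph] using (hg (.inr (.inr ⟨l', j⟩)) (by simp)).symm
      · cases b
        · simpa [hfalse, clusterTgt, correctnessGraph] using hge'
        · simp only [htrue, clusterTgt, Sum.elim_inr, Sum.elim_inl, and_self, if_true]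
          exact fun h => hge' h.symm
    · obtain ⟨k, hk, hφk⟩ := hlink l x
      obtain ⟨g, hg, hge⟩ := (htree I rfl).exists_bridge (.inr (.inr ⟨l, k⟩))
      refine ⟨Sum.elim g fun c => g (S.cutL c), ?_, ?_⟩
      · rintro (a' | ⟨c', (_ | _)⟩ | ⟨l', x'⟩) - hne
        · simpa [hax, clusterTgt, correctnessGraph] using hg (.inl a') (by simp)
        · simpa [hfalse, clusterTgt, correctnessGraph] using hg (.inr (.inl c')) (by simp)
        · simp [htrue, clusterTgt]
        · obtain ⟨j, hj, hφj⟩ := hlink l' x'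
          have := (hg (.inr (.inr ⟨l', j⟩)) (by
            intro he
            simp only [Sum.inr.injEq, Sigma.mk.injEq] at he
            obtain ⟨rfl, he⟩ := he
            obtain rfl := eq_of_heq he
            exact hne (by rw [← hj, ← hk]))).symm
          simpa [hφj, clusterTgt, correctnessGraph] using this
      · intro h
        rw [hφk] at h
        exact hge h.symm

end LinkGraph

/-! ## Translations with control of the terminal nodes -/

namespace LinkGraph

variable {ι : Type u} {σ : Signature ι}

/-- `T` is the translation of a proof whose sequent contains the labels of the terminal nodes. -/
def HasProof (T : LinkGraph σ) : Prop :=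
  ∃ (Γ : Multiset (Formula σ)) (π : SeqProof σ Γ), Translates π T ∧
    ∀ s : Finset T.Node, (∀ v ∈ s, T.Terminal v) → ∑ v ∈ s, {T.label v} ≤ Γ

theorem hasProof_axiomLink (k : ℕ) : HasProof (axiomLink σ k) := by
  have key : ∀ s : Finset Bool, ∑ b ∈ s, ({.lit b k} : Multiset (Formula σ)) ≤
      {.lit true k, .lit false k} := fun s => by
    refine (Finset.sum_le_sum_of_subset (M := Multiset (Formula σ)) s.subset_univ).trans ?_
    rw [Fintype.sum_bool]
    rfl
  exact ⟨_, .ax k, .ax k, fun s _ => key s⟩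

theorem Iso.terminal {S T : LinkGraph σ} (f : Iso S T) {v : S.Node} (hv : T.Terminal (f.node v)) :
    S.Terminal v := by
  rintro (c | c | ⟨l, j⟩) rfl
  · exact hv (.inl (f.cut c)) (f.cutL_cut c)
  · exact hv (.inr (.inl (f.cut c))) (f.cutR_cut c)
  · refine hv (.inr (.inr ⟨f.clink l,
      Fin.cast (congrArg (Conn.arity σ) (f.conn_clink l)).symm j⟩)) ?_
    exact f.prem_clink l _

theorem HasProof.iso {S T : LinkGraph σ} (h : HasProof S) (f : Iso S T) : HasProof T := by
  obtain ⟨Γ, π, hπ, hΓ⟩ := h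
  refine ⟨Γ, π, .iso hπ f, fun s hs => ?_⟩
  have := hΓ (s.map f.node.symm.toEmbedding) (by
    intro v hv
    obtain ⟨w, hw, rfl⟩ := Finset.mem_map.1 hv
    exact f.terminal (by simpa using hs w hw))
  rw [Finset.sum_map] at this
  refine le_of_eq_of_le (Finset.sum_congr rfl fun v _ => ?_) this
  simp [← f.label_node]

/-- The rule needs the cut formula inside the sequent, and the bound in `HasProof` supplies it. The
bound for the new sequent comes from adding the cut node to a set of terminal nodes of each premise
and cancelling its label. Quantifying over finite sets of nodes avoids any finiteness assumption. -/
theorem HasProof.addCut {S T : LinkGraph σ} (hS : HasProof S) (hT : HasProof T)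
    {a : S.Node} {b : T.Node} (ha : S.Terminal a) (hb : T.Terminal b)
    (hab : T.label b = (S.label a).neg) : HasProof (addCut S T a b) := by
  classical
  obtain ⟨Γ', π₁, hπ₁, hΓ⟩ := hS
  obtain ⟨Δ', π₂, hπ₂, hΔ⟩ := hT
  obtain ⟨Γ, rfl⟩ : ∃ Γ, Γ' = Γ + {S.label a} := by
    obtain ⟨Γ, h⟩ := Multiset.le_iff_exists_add.1 (hΓ {a} (by simpa using ha))
    exact ⟨Γ, by rw [h, Finset.sum_singleton, add_comm]⟩
  obtain ⟨Δ, rfl⟩ : ∃ Δ, Δ' = Δ + {(S.label a).neg} := by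
    obtain ⟨Δ, h⟩ := Multiset.le_iff_exists_add.1 (hΔ {b} (by simpa using hb))
    exact ⟨Δ, by rw [h, Finset.sum_singleton, add_comm, hab]⟩
  refine ⟨_, .cut _ Γ Δ π₁ π₂, .cut hπ₁ hπ₂ a b ha hb rfl hab, fun s hs => ?_⟩
  have hs1 : ∑ v ∈ s.toLeft, {S.label v} ≤ Γ := by
    have has : a ∉ s.toLeft := fun h => hs _ (Finset.mem_toLeft.1 h) (.inl none) rfl
    have := hΓ (insert a s.toLeft) (by
      intro v hv
      rcases Finset.mem_insert.1 hv with rfl | hv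
      · exact ha
      · have hv' := hs _ (Finset.mem_toLeft.1 hv)
        rintro (c | c | ⟨l, j⟩) rfl
        · exact hv' (.inl (some (.inl c))) rfl
        · exact hv' (.inr (.inl (some (.inl c)))) rfl
        · exact hv' (.inr (.inr ⟨.inl l, j⟩)) rfl)
    rw [Finset.sum_insert has, add_comm] at this
    exact le_of_add_le_add_right this
  have hs2 : ∑ v ∈ s.toRight, {T.label v} ≤ Δ := by
    have hbs : b ∉ s.toRight := fun h => hs _ (Finset.mem_toRight.1 h) (.inr (.inl none)) rfl
    have := hΔ (insert b s.toRight) (by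
      intro v hv
      rcases Finset.mem_insert.1 hv with rfl | hv
      · exact hb
      · have hv' := hs _ (Finset.mem_toRight.1 hv)
        rintro (c | c | ⟨l, j⟩) rfl
        · exact hv' (.inl (some (.inr c))) rfl
        · exact hv' (.inr (.inl (some (.inr c)))) rfl
        · exact hv' (.inr (.inr ⟨.inr l, j⟩)) rfl)
    rw [Finset.sum_insert hbs, hab, add_comm] at this
    exact le_of_add_le_add_right this
  have hsum : ∑ v ∈ s, {(S.addCut T a b).label v} =
      ∑ v ∈ s.toLeft, ({S.label v} : Multiset (Formula σ)) + ∑ v ∈ s.toRight, {T.label v} := by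
    conv_lhs => rw [← Finset.toLeft_disjSum_toRight (u := s)]
    exact Finset.sum_disjSum _ _ _
  rw [hsum]
  exact add_le_add hs1 hs2

theorem _root_.Multiset.sum_singleton_eq_map {α β : Type*} (s : Finset α) (f : α → β) :
    ∑ a ∈ s, ({f a} : Multiset β) = s.val.map f := by
  rw [Finset.sum_eq_multiset_sum, ← Multiset.sum_map_singleton (s.val.map f), Multiset.map_map]
  rfl

/-- In each component the nodes used as premises carry exactly the formulas of its class. They are
split off from the sequent of the component, and the remaining terminal nodes are bounded by its
context. -/
theorem HasProof.addConn {c : Conn ι} {p : NPartition (c.arity σ)} (hp : p ∈ c.partitions σ)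
    {T : {x // x ∈ p.parts} → LinkGraph σ} (hT : ∀ x, HasProof (T x))
    (e : Fin (c.arity σ) → Σ x, (T x).Node) (he : Function.Injective e)
    (hclass : ∀ j, j ∈ (e j).1.1) (hterm : ∀ j, (T (e j).1).Terminal (e j).2) :
    HasProof (addConn T c e) := by
  classical
  let mk : (x : {x // x ∈ p.parts}) → (T x).Node → Σ x, (T x).Node := fun x v => ⟨x, v⟩
  have hmk : ∀ x, Function.Injective (mk x) := fun x v w h => by
    simpa [mk] using h
  set args : Fin (c.arity σ) → Formula σ := fun j => (T (e j).1).label (e j).2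
  have hsplit : ∀ x, ∃ (Γ : Multiset (Formula σ)) (π : SeqProof σ (Γ + x.1.val.map args)),
      Translates π (T x) ∧ ∀ s : Finset (T x).Node,
        (∀ v ∈ s, (T x).Terminal v ∧ ∀ j, e j ≠ ⟨x, v⟩) → ∑ v ∈ s, {(T x).label v} ≤ Γ := by
    intro x
    obtain ⟨Γ', π, hπ, hΓ⟩ := hT x
    let E : Finset (T x).Node :=
      (Finset.univ.image e).preimage (mk x) (hmk x).injOn
    have hE : ∀ v, v ∈ E ↔ ∃ j, e j = ⟨x, v⟩ := by simp [E, mk]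
    have hEterm : ∀ v ∈ E, (T x).Terminal v := by
      intro v hv
      obtain ⟨j, hj⟩ := (hE v).1 hv
      have := hterm j
      rwa [hj] at this
    have hEsum : ∑ v ∈ E, {(T x).label v} = x.1.val.map args := by
      rw [← Multiset.sum_singleton_eq_map]
      -- Since the classes are disjoint, the premises lying in component `x` are precisely those
      -- indexed by the class `x`.
      have hmap : E.map ⟨mk x, hmk x⟩ = x.1.map ⟨e, he⟩ := by
        ext w
        simp only [Finset.mem_map, Function.Embedding.coeFn_mk]
        constructor
        · rintro ⟨v, hv, rfl⟩
          obtain ⟨j, hj⟩ := (hE v).1 hv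
          refine ⟨j, ?_, hj⟩
          have := hclass j
          rwa [hj] at this
        · rintro ⟨j, hj, rfl⟩
          have hx : (e j).1 = x := by
            by_contra hne
            have h1 := (p.part_eq_of_mem x.2 hj)
            have h2 := (p.part_eq_of_mem (e j).1.2 (hclass j))
            exact hne (Subtype.ext (h2.symm.trans h1))
          subst hx
          exact ⟨(e j).2, (hE _).2 ⟨j, rfl⟩, rfl⟩
      have h1 := Finset.sum_map E ⟨mk x, hmk x⟩
        (fun w => ({(T w.1).label w.2} : Multiset (Formula σ)))
      have h2 := Finset.sum_map x.1 ⟨e, he⟩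
        (fun w => ({(T w.1).label w.2} : Multiset (Formula σ)))
      rw [hmap, h2] at h1
      exact h1.symm
    obtain ⟨Γ, rfl⟩ : ∃ Γ, Γ' = Γ + x.1.val.map args := by
      obtain ⟨Γ, h⟩ := Multiset.le_iff_exists_add.1 (hΓ E hEterm)
      exact ⟨Γ, by rw [h, hEsum, add_comm]⟩
    refine ⟨Γ, π, hπ, fun s hs => ?_⟩
    have hdisj : Disjoint s E := Finset.disjoint_left.2 fun v hv hvE => by
      obtain ⟨j, hj⟩ := (hE v).1 hvE
      exact (hs v hv).2 j hj
    have := hΓ (s ∪ E) (by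
      intro v hv
      rcases Finset.mem_union.1 hv with hv | hv
      · exact (hs v hv).1
      · exact hEterm v hv)
    rw [Finset.sum_union hdisj, hEsum] at this
    exact le_of_add_le_add_right this
  choose Γ π hπ hΓ using hsplit
  let lab : Option (Σ x, (T x).Node) → Formula σ := (LinkGraph.addConn T c e).label
  have key : ∀ s : Finset (Option (Σ x, (T x).Node)),
      (∀ x v, some ⟨x, v⟩ ∈ s → (T x).Terminal v ∧ ∀ j, e j ≠ ⟨x, v⟩) →
        ∑ v ∈ s, {lab v} ≤ ∑ x, Γ x + {.comp c args} := by
    intro s hs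
    let F : Finset (Σ x, (T x).Node) := Finset.eraseNone s
    let G : (x : {x // x ∈ p.parts}) → Finset (T x).Node :=
      fun x => F.preimage (mk x) (hmk x).injOn
    -- The new conclusion accounts for the compound formula; all other nodes are sorted by
    -- component.
    have hsF : s ⊆ Finset.insertNone F := by
      rintro (_ | v) hv
      · simp
      · simpa [F] using hv
    have hFG : F ⊆ Finset.univ.sigma G := by
      rintro ⟨x, v⟩ hv
      simpa [G, mk] using hv
    refine (Finset.sum_le_sum_of_subset (M := Multiset (Formula σ)) hsF).trans ?_
    rw [Finset.sum_insertNone, add_comm]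
    refine add_le_add ?_ le_rfl
    refine (Finset.sum_le_sum_of_subset (M := Multiset (Formula σ)) hFG).trans ?_
    rw [Finset.sum_sigma]
    exact Finset.sum_le_sum fun x _ => hΓ x (G x) fun v hv =>
      hs x v (by simpa [G, F, mk] using hv)
  refine ⟨_, .intro c p hp args Γ π, .intro hπ e he hclass hterm fun j => rfl, fun s hs =>
    key s fun x v hv => ?_⟩
  have hv' := hs (some ⟨x, v⟩) hv
  refine ⟨?_, fun j hj => hv' (.inr (.inr ⟨none, j⟩)) (congrArg some hj)⟩
  rintro (d | d | ⟨l, j⟩) rfl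
  · exact hv' (.inl ⟨x, d⟩) rfl
  · exact hv' (.inr (.inl ⟨x, d⟩)) rfl
  · exact hv' (.inr (.inr ⟨some ⟨x, l⟩, j⟩)) rfl

/-! ## Substructures -/

/-- The nodes in `N` and the cut links in `C` form a substructure. -/
structure Closed (S : LinkGraph σ) (N : Set S.Node) (C : Set S.Cut) : Prop where
  axNeg_mem : ∀ a, S.axPos a ∈ N → S.axNeg a ∈ N
  cutL_mem : ∀ c ∈ C, S.cutL c ∈ N
  cutR_mem : ∀ c ∈ C, S.cutR c ∈ N
  prem_mem : ∀ l, S.concl l ∈ N → ∀ j, S.prem l j ∈ N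

/-- The substructure with nodes `N` and cut links `C`. -/
def sub (S : LinkGraph σ) (N : Set S.Node) (C : Set S.Cut) (h : S.Closed N C) : LinkGraph σ where
  Node := {v // v ∈ N}
  Ax := {a // S.axPos a ∈ N}
  Cut := {c // c ∈ C}
  CLink := {l // S.concl l ∈ N}
  label v := S.label v.1
  axPos a := ⟨S.axPos a.1, a.2⟩
  axNeg a := ⟨S.axNeg a.1, h.axNeg_mem a.1 a.2⟩
  cutL c := ⟨S.cutL c.1, h.cutL_mem c.1 c.2⟩
  cutR c := ⟨S.cutR c.1, h.cutR_mem c.1 c.2⟩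
  conn l := S.conn l.1
  prem l j := ⟨S.prem l.1 j, h.prem_mem l.1 l.2 j⟩
  concl l := ⟨S.concl l.1, l.2⟩

/-- The nodes in `N` and the cut links in `C` form the translation of a proof. -/
def ProvedPart (S : LinkGraph σ) (N : Set S.Node) (C : Set S.Cut) : Prop :=
  ∃ h : S.Closed N C, HasProof (S.sub N C h)

theorem ProvedPart.sequentializable {S : LinkGraph σ} (h : S.ProvedPart Set.univ Set.univ) :
    S.Sequentializable := by
  obtain ⟨hc, Γ, π, hπ, -⟩ := h
  refine ⟨Γ, π, .iso hπ ?_⟩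
  exact
    { node := Equiv.Set.univ _
      ax := Equiv.subtypeUnivEquiv fun _ => trivial
      cut := Equiv.Set.univ _
      clink := Equiv.subtypeUnivEquiv fun _ => trivial
      label_node := fun _ => rfl
      axPos_ax := fun _ => rfl
      axNeg_ax := fun _ => rfl
      cutL_cut := fun _ => rfl
      cutR_cut := fun _ => rfl
      conn_clink := fun _ => rfl
      prem_clink := fun _ _ => rfl
      concl_clink := fun _ => rfl }

end LinkGraph

/-! ### Substructures obtained by applying a rule -/

namespace ProofStructure

open LinkGraph

variable {ι : Type u} {σ : Signature ι} (S : ProofStructure σ)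

theorem provedPart_ax (a : S.Ax) : S.ProvedPart {S.axPos a, S.axNeg a} ∅ := by
  have hinj := S.conclusion_bijective.1
  have hl : ∀ l, S.concl l ∉ ({S.axPos a, S.axNeg a} : Set S.Node) := by
    rintro l (h | h)
    · exact absurd (@hinj (.inr (.inr l)) (.inl a) h) (by simp)
    · exact absurd (@hinj (.inr (.inr l)) (.inr (.inl a)) h) (by simp)
  have ha : ∀ a', S.axPos a' ∈ ({S.axPos a, S.axNeg a} : Set S.Node) → a' = a := by
    rintro a' (h | h)
    · simpa using @hinj (.inl a') (.inl a) h
    · exact absurd (@hinj (.inl a') (.inr (.inl a)) h) (by simp)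
  have hne : S.axPos a ≠ S.axNeg a := fun h =>
    absurd (@hinj (.inl a) (.inr (.inl a)) h) (by simp)
  have hc : S.Closed {S.axPos a, S.axNeg a} ∅ :=
    ⟨fun a' h => by rw [ha a' h]; simp, by simp, by simp, fun l h => absurd h (hl l)⟩
  obtain ⟨k, hk1, hk2⟩ := S.label_ax a
  refine ⟨hc, (hasProof_axiomLink k).iso ?_⟩
  let f : Bool → {v // v ∈ ({S.axPos a, S.axNeg a} : Set S.Node)} := fun b =>
    if b then ⟨S.axPos a, by simp⟩ else ⟨S.axNeg a, by simp⟩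
  have hf : Function.Bijective f := by
    constructor
    · rintro (_ | _) (_ | _) h <;> simp [f, hne, hne.symm] at h ⊢
    · rintro ⟨v, rfl | rfl⟩
      · exact ⟨true, rfl⟩
      · exact ⟨false, rfl⟩
  have : IsEmpty {l // S.concl l ∈ ({S.axPos a, S.axNeg a} : Set S.Node)} :=
    ⟨fun l => hl l.1 l.2⟩
  let g : Unit ≃ {a' // S.axPos a' ∈ ({S.axPos a, S.axNeg a} : Set S.Node)} :=
    ⟨fun _ => ⟨a, by simp⟩, fun _ => (), fun _ => rfl, fun a' => Subtype.ext (ha a'.1 a'.2).symm⟩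
  exact
    { node := Equiv.ofBijective f hf
      ax := g
      cut := (Equiv.equivEmpty {c // c ∈ (∅ : Set S.Cut)}).symm
      clink := (Equiv.equivEmpty {l // S.concl l ∈ ({S.axPos a, S.axNeg a} : Set S.Node)}).symm
      label_node := by rintro (_ | _) <;> [exact hk2; exact hk1]
      axPos_ax := fun _ => rfl
      axNeg_ax := fun _ => rfl
      cutL_cut := fun c => Empty.elim c
      cutR_cut := fun c => Empty.elim c
      conn_clink := fun l => Empty.elim l
      prem_clink := fun l => Empty.elim l
      concl_clink := fun l => Empty.elim l }

variable {S}

theorem provedPart_cut (c : S.Cut) {N₁ N₂ : Set S.Node} {C₁ C₂ : Set S.Cut}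
    (h₁ : S.ProvedPart N₁ C₁) (h₂ : S.ProvedPart N₂ C₂) (hdisj : Disjoint N₁ N₂)
    (hL : S.cutL c ∈ N₁) (hR : S.cutR c ∈ N₂) :
    S.ProvedPart (N₁ ∪ N₂) (insert c (C₁ ∪ C₂)) := by
  obtain ⟨hc₁, hp₁⟩ := h₁
  obtain ⟨hc₂, hp₂⟩ := h₂
  have hnot : ∀ v, v ∈ N₁ → v ∉ N₂ := fun v h => Set.disjoint_left.1 hdisj h
  have hinj := S.premise_injective
  have hc : S.Closed (N₁ ∪ N₂) (insert c (C₁ ∪ C₂)) := by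
    refine ⟨fun a h => h.imp (hc₁.axNeg_mem a) (hc₂.axNeg_mem a), ?_, ?_,
      fun l h j => h.imp (hc₁.prem_mem l · j) (hc₂.prem_mem l · j)⟩
    · rintro d (rfl | hd | hd)
      · exact Or.inl hL
      · exact Or.inl (hc₁.cutL_mem d hd)
      · exact Or.inr (hc₂.cutL_mem d hd)
    · rintro d (rfl | hd | hd)
      · exact Or.inr hR
      · exact Or.inl (hc₁.cutR_mem d hd)
      · exact Or.inr (hc₂.cutR_mem d hd)
  -- The cut is in neither part because its premises lie in disjoint parts. Each premise is
  -- therefore still terminal in its part.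
  have hcC₁ : c ∉ C₁ := fun h => hnot _ (hc₁.cutR_mem c h) hR
  have hcC₂ : c ∉ C₂ := fun h => hnot _ hL (hc₂.cutL_mem c h)
  have hCC : ∀ d, d ∈ C₁ → d ∉ C₂ := fun d h h' => hnot _ (hc₁.cutL_mem d h) (hc₂.cutL_mem d h')
  have ha : (S.sub N₁ C₁ hc₁).Terminal ⟨S.cutL c, hL⟩ := by
    rintro (d | d | ⟨l, j⟩) h
    · have := @hinj (.inl d.1) (.inl c) (congrArg Subtype.val h)
      simp only [Sum.inl.injEq] at this
      exact hcC₁ (this ▸ d.2)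
    · exact absurd (@hinj (.inr (.inl d.1)) (.inl c) (congrArg Subtype.val h)) (by simp)
    · exact absurd (@hinj (.inr (.inr ⟨l.1, j⟩)) (.inl c) (congrArg Subtype.val h)) (by simp)
  have hb : (S.sub N₂ C₂ hc₂).Terminal ⟨S.cutR c, hR⟩ := by
    rintro (d | d | ⟨l, j⟩) h
    · exact absurd (@hinj (.inl d.1) (.inr (.inl c)) (congrArg Subtype.val h)) (by simp)
    · have := @hinj (.inr (.inl d.1)) (.inr (.inl c)) (congrArg Subtype.val h)
      simp only [Sum.inr.injEq, Sum.inl.injEq] at this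
      exact hcC₂ (this ▸ d.2)
    · exact absurd (@hinj (.inr (.inr ⟨l.1, j⟩)) (.inr (.inl c)) (congrArg Subtype.val h))
        (by simp)
  refine ⟨hc, (hp₁.addCut hp₂ ha hb (S.label_cut c)).iso ?_⟩
  let fN : {v // v ∈ N₁} ⊕ {v // v ∈ N₂} → {v // v ∈ N₁ ∪ N₂} :=
    Sum.elim (fun v => ⟨v.1, Or.inl v.2⟩) fun v => ⟨v.1, Or.inr v.2⟩
  let fA : {a // S.axPos a ∈ N₁} ⊕ {a // S.axPos a ∈ N₂} → {a // S.axPos a ∈ N₁ ∪ N₂} :=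
    Sum.elim (fun v => ⟨v.1, Or.inl v.2⟩) fun v => ⟨v.1, Or.inr v.2⟩
  let fL : {l // S.concl l ∈ N₁} ⊕ {l // S.concl l ∈ N₂} → {l // S.concl l ∈ N₁ ∪ N₂} :=
    Sum.elim (fun v => ⟨v.1, Or.inl v.2⟩) fun v => ⟨v.1, Or.inr v.2⟩
  let fC : Option ({d // d ∈ C₁} ⊕ {d // d ∈ C₂}) → {d // d ∈ insert c (C₁ ∪ C₂)} := fun o =>
    o.elim ⟨c, Or.inl rfl⟩
      (Sum.elim (fun v => ⟨v.1, Or.inr (Or.inl v.2)⟩) fun v => ⟨v.1, Or.inr (Or.inr v.2)⟩)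
  have hfN : Function.Bijective fN := by
    constructor
    · rintro (⟨v, hv⟩ | ⟨v, hv⟩) (⟨w, hw⟩ | ⟨w, hw⟩) h <;>
        obtain rfl : v = w := congrArg Subtype.val h
      · rfl
      · exact absurd hw (hnot v hv)
      · exact absurd hv (hnot v hw)
      · rfl
    · rintro ⟨v, hv | hv⟩
      exacts [⟨.inl ⟨v, hv⟩, rfl⟩, ⟨.inr ⟨v, hv⟩, rfl⟩]
  have hfA : Function.Bijective fA := by
    constructor
    · rintro (⟨v, hv⟩ | ⟨v, hv⟩) (⟨w, hw⟩ | ⟨w, hw⟩) h <;>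
        obtain rfl : v = w := congrArg Subtype.val h
      · rfl
      · exact absurd hw (hnot _ hv)
      · exact absurd hv (hnot _ hw)
      · rfl
    · rintro ⟨v, hv | hv⟩
      exacts [⟨.inl ⟨v, hv⟩, rfl⟩, ⟨.inr ⟨v, hv⟩, rfl⟩]
  have hfL : Function.Bijective fL := by
    constructor
    · rintro (⟨v, hv⟩ | ⟨v, hv⟩) (⟨w, hw⟩ | ⟨w, hw⟩) h <;>
        obtain rfl : v = w := congrArg Subtype.val h
      · rfl
      · exact absurd hw (hnot _ hv)
      · exact absurd hv (hnot _ hw)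
      · rfl
    · rintro ⟨v, hv | hv⟩
      exacts [⟨.inl ⟨v, hv⟩, rfl⟩, ⟨.inr ⟨v, hv⟩, rfl⟩]
  have hfC : Function.Bijective fC := by
    constructor
    · rintro (_ | ⟨v, hv⟩ | ⟨v, hv⟩) (_ | ⟨w, hw⟩ | ⟨w, hw⟩) h
      · rfl
      · obtain rfl : c = w := congrArg Subtype.val h
        exact absurd hw hcC₁
      · obtain rfl : c = w := congrArg Subtype.val h
        exact absurd hw hcC₂
      · obtain rfl : v = c := congrArg Subtype.val h
        exact absurd hv hcC₁
      · obtain rfl : v = w := congrArg Subtype.val h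
        rfl
      · obtain rfl : v = w := congrArg Subtype.val h
        exact absurd hw (hCC v hv)
      · obtain rfl : v = c := congrArg Subtype.val h
        exact absurd hv hcC₂
      · obtain rfl : v = w := congrArg Subtype.val h
        exact absurd hv (hCC v hw)
      · obtain rfl : v = w := congrArg Subtype.val h
        rfl
    · rintro ⟨v, rfl | hv | hv⟩
      exacts [⟨none, rfl⟩, ⟨some (.inl ⟨v, hv⟩), rfl⟩, ⟨some (.inr ⟨v, hv⟩), rfl⟩]
  exact
    { node := Equiv.ofBijective fN hfN
      ax := Equiv.ofBijective fA hfA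
      cut := Equiv.ofBijective fC hfC
      clink := Equiv.ofBijective fL hfL
      label_node := by rintro (v | v) <;> rfl
      axPos_ax := by rintro (v | v) <;> rfl
      axNeg_ax := by rintro (v | v) <;> rfl
      cutL_cut := by rintro (_ | v | v) <;> rfl
      cutR_cut := by rintro (_ | v | v) <;> rfl
      conn_clink := by rintro (v | v) <;> rfl
      prem_clink := by rintro (v | v) j <;> rfl
      concl_clink := by rintro (v | v) <;> rfl }

theorem provedPart_conn (l : S.CLink) {p : NPartition ((S.conn l).arity σ)}
    (hp : p ∈ (S.conn l).partitions σ) {N : {x // x ∈ p.parts} → Set S.Node}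
    {C : {x // x ∈ p.parts} → Set S.Cut} (h : ∀ x, S.ProvedPart (N x) (C x))
    (hdisj : Pairwise fun x y => Disjoint (N x) (N y)) (hl : ∀ x, S.concl l ∉ N x)
    (hprem : ∀ j, S.prem l j ∈ N (NPartition.classOf p j)) :
    S.ProvedPart (insert (S.concl l) (⋃ x, N x)) (⋃ x, C x) := by
  choose hc hpr using h
  have huniq : ∀ {x y v}, v ∈ N x → v ∈ N y → x = y := fun {x y v} hx hy => by
    by_contra hne
    exact Set.disjoint_left.1 (hdisj hne) hx hy
  have hinj := S.premise_injective
  have hcinj := S.conclusion_bijective.1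
  have hconcl : ∀ {l'}, S.concl l' = S.concl l → l' = l := fun {l'} h => by
    simpa using @hcinj (.inr (.inr l')) (.inr (.inr l)) h
  have haxl : ∀ a, S.axPos a ≠ S.concl l := fun a h =>
    absurd (@hcinj (.inl a) (.inr (.inr l)) h) (by simp)
  have hcl : S.Closed (insert (S.concl l) (⋃ x, N x)) (⋃ x, C x) := by
    refine ⟨?_, ?_, ?_, ?_⟩
    · rintro a (h | h)
      · exact absurd h (haxl a)
      · obtain ⟨x, hx⟩ := Set.mem_iUnion.1 h
        exact Or.inr (Set.mem_iUnion.2 ⟨x, (hc x).axNeg_mem a hx⟩)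
    · intro d hd
      obtain ⟨x, hx⟩ := Set.mem_iUnion.1 hd
      exact Or.inr (Set.mem_iUnion.2 ⟨x, (hc x).cutL_mem d hx⟩)
    · intro d hd
      obtain ⟨x, hx⟩ := Set.mem_iUnion.1 hd
      exact Or.inr (Set.mem_iUnion.2 ⟨x, (hc x).cutR_mem d hx⟩)
    · rintro l' (h | h) j
      · obtain rfl := hconcl h
        exact Or.inr (Set.mem_iUnion.2 ⟨_, hprem j⟩)
      · obtain ⟨x, hx⟩ := Set.mem_iUnion.1 h
        exact Or.inr (Set.mem_iUnion.2 ⟨x, (hc x).prem_mem l' hx j⟩)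
  let T : {x // x ∈ p.parts} → LinkGraph σ := fun x => S.sub (N x) (C x) (hc x)
  let e : Fin ((S.conn l).arity σ) → Σ x, (T x).Node := fun j =>
    ⟨NPartition.classOf p j, ⟨S.prem l j, hprem j⟩⟩
  have hval : ∀ {v w : Σ x, (T x).Node}, v.2.1 = w.2.1 → v = w := by
    rintro ⟨x, v, hv⟩ ⟨y, w, hw⟩ h
    obtain rfl : v = w := h
    obtain rfl := huniq hv hw
    rfl
  have he : Function.Injective e := fun i j hij => by
    have h1 : S.prem l i = S.prem l j := congrArg (fun v : Σ x, (T x).Node => v.2.1) hij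
    have h2 := @hinj (.inr (.inr ⟨l, i⟩)) (.inr (.inr ⟨l, j⟩)) h1
    simpa using h2
  -- A premise of `l` is a premise of no other link, and `l` itself belongs to no part since its
  -- conclusion does not.
  have hterm : ∀ j, (T (e j).1).Terminal (e j).2 := by
    rintro j (d | d | ⟨l', i⟩) h
    · exact absurd (@hinj (.inl d.1) (.inr (.inr ⟨l, j⟩)) (congrArg Subtype.val h)) (by simp)
    · exact absurd (@hinj (.inr (.inl d.1)) (.inr (.inr ⟨l, j⟩)) (congrArg Subtype.val h))
        (by simp)
    · have := @hinj (.inr (.inr ⟨l'.1, i⟩)) (.inr (.inr ⟨l, j⟩)) (congrArg Subtype.val h)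
      have hll : l'.1 = l := congrArg Sigma.fst (Sum.inr_injective (Sum.inr_injective this))
      exact hl _ (hll ▸ l'.2)
  refine ⟨hcl, (HasProof.addConn hp hpr e he (fun j => p.mem_part (Finset.mem_univ j))
    hterm).iso ?_⟩
  let fN : Option (Σ x, {v // v ∈ N x}) → {v // v ∈ insert (S.concl l) (⋃ x, N x)} := fun o =>
    o.elim ⟨S.concl l, Or.inl rfl⟩ fun v => ⟨v.2.1, Or.inr (Set.mem_iUnion.2 ⟨v.1, v.2.2⟩)⟩
  let fA : (Σ x, {a // S.axPos a ∈ N x}) → {a // S.axPos a ∈ insert (S.concl l) (⋃ x, N x)} :=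
    fun v => ⟨v.2.1, Or.inr (Set.mem_iUnion.2 ⟨v.1, v.2.2⟩)⟩
  let fC : (Σ x, {d // d ∈ C x}) → {d // d ∈ ⋃ x, C x} :=
    fun v => ⟨v.2.1, Set.mem_iUnion.2 ⟨v.1, v.2.2⟩⟩
  let fL : Option (Σ x, {l' // S.concl l' ∈ N x}) →
      {l' // S.concl l' ∈ insert (S.concl l) (⋃ x, N x)} := fun o =>
    o.elim ⟨l, Or.inl rfl⟩ fun v => ⟨v.2.1, Or.inr (Set.mem_iUnion.2 ⟨v.1, v.2.2⟩)⟩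
  have hfN : Function.Bijective fN := by
    constructor
    · rintro (_ | ⟨x, v, hv⟩) (_ | ⟨y, w, hw⟩) h
      · rfl
      · obtain rfl : S.concl l = w := congrArg Subtype.val h
        exact absurd hw (hl y)
      · obtain rfl : v = S.concl l := congrArg Subtype.val h
        exact absurd hv (hl x)
      · obtain rfl : v = w := congrArg Subtype.val h
        obtain rfl := huniq hv hw
        rfl
    · rintro ⟨v, rfl | hv⟩
      · exact ⟨none, rfl⟩
      · obtain ⟨x, hx⟩ := Set.mem_iUnion.1 hv
        exact ⟨some ⟨x, v, hx⟩, rfl⟩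
  have hfA : Function.Bijective fA := by
    constructor
    · rintro ⟨x, v, hv⟩ ⟨y, w, hw⟩ h
      obtain rfl : v = w := congrArg Subtype.val h
      obtain rfl := huniq hv hw
      rfl
    · rintro ⟨v, hv | hv⟩
      · exact absurd hv (haxl v)
      · obtain ⟨x, hx⟩ := Set.mem_iUnion.1 hv
        exact ⟨⟨x, v, hx⟩, rfl⟩
  have hfC : Function.Bijective fC := by
    constructor
    · rintro ⟨x, v, hv⟩ ⟨y, w, hw⟩ h
      obtain rfl : v = w := congrArg Subtype.val h
      obtain rfl := huniq ((hc x).cutL_mem v hv) ((hc y).cutL_mem v hw)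
      rfl
    · rintro ⟨v, hv⟩
      obtain ⟨x, hx⟩ := Set.mem_iUnion.1 hv
      exact ⟨⟨x, v, hx⟩, rfl⟩
  have hfL : Function.Bijective fL := by
    constructor
    · rintro (_ | ⟨x, v, hv⟩) (_ | ⟨y, w, hw⟩) h
      · rfl
      · obtain rfl : l = w := congrArg Subtype.val h
        exact absurd hw (hl y)
      · obtain rfl : v = l := congrArg Subtype.val h
        exact absurd hv (hl x)
      · obtain rfl : v = w := congrArg Subtype.val h
        obtain rfl := huniq hv hw
        rfl
    · rintro ⟨v, hv | hv⟩
      · obtain rfl := hconcl hv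
        exact ⟨none, rfl⟩
      · obtain ⟨x, hx⟩ := Set.mem_iUnion.1 hv
        exact ⟨some ⟨x, v, hx⟩, rfl⟩
  exact
    { node := Equiv.ofBijective fN hfN
      ax := Equiv.ofBijective fA hfA
      cut := Equiv.ofBijective fC hfC
      clink := Equiv.ofBijective fL hfL
      label_node := by rintro (_ | v) <;> [exact S.label_conn l; rfl]
      axPos_ax := fun _ => rfl
      axNeg_ax := fun _ => rfl
      cutL_cut := fun _ => rfl
      cutR_cut := fun _ => rfl
      conn_clink := by rintro (_ | v) <;> rfl
      prem_clink := by rintro (_ | v) j <;> rfl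
      concl_clink := by rintro (_ | v) <;> rfl }

end ProofStructure

/-! ## Sequentialization -/

namespace ProofStructure

open LinkGraph

variable {ι : Type u} {σ : Signature ι} (S : ProofStructure σ)
  (p : (l : S.CLink) → NPartition ((S.conn l).arity σ))

theorem node_cases (v : S.Node) :
    (∃ a, v = S.axPos a) ∨ (∃ a, v = S.axNeg a) ∨ ∃ l, v = S.concl l := by
  obtain ⟨a | a | l, rfl⟩ := S.conclusion_bijective.2 v
  exacts [Or.inl ⟨a, rfl⟩, Or.inr (Or.inl ⟨a, rfl⟩), Or.inr (Or.inr ⟨l, rfl⟩)]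

theorem conclusionAt_inj {x y} (h : S.conclusionAt x = S.conclusionAt y) : x = y :=
  S.conclusion_bijective.1 h

theorem premiseAt_inj {x y} (h : S.premiseAt x = S.premiseAt y) : x = y :=
  S.premise_injective h

theorem axPos_ne_axNeg (a b : S.Ax) : S.axPos a ≠ S.axNeg b := fun h =>
  absurd (S.conclusionAt_inj (x := .inl a) (y := .inr (.inl b)) h) (by simp)

theorem axPos_ne_concl (a : S.Ax) (l : S.CLink) : S.axPos a ≠ S.concl l := fun h =>
  absurd (S.conclusionAt_inj (x := .inl a) (y := .inr (.inr l)) h) (by simp)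

theorem axNeg_ne_concl (a : S.Ax) (l : S.CLink) : S.axNeg a ≠ S.concl l := fun h =>
  absurd (S.conclusionAt_inj (x := .inr (.inl a)) (y := .inr (.inr l)) h) (by simp)

theorem axPos_injective : Function.Injective S.axPos := fun a b h => by
  simpa using S.conclusionAt_inj (x := .inl a) (y := .inl b) h

theorem axNeg_injective : Function.Injective S.axNeg := fun a b h => by
  simpa using S.conclusionAt_inj (x := .inr (.inl a)) (y := .inr (.inl b)) h

theorem concl_injective : Function.Injective S.concl := fun a b h => by
  simpa using S.conclusionAt_inj (x := .inr (.inr a)) (y := .inr (.inr b)) h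

theorem cutL_injective : Function.Injective S.cutL := fun a b h => by
  simpa using S.premiseAt_inj (x := .inl a) (y := .inl b) h

theorem prem_injective (l : S.CLink) : Function.Injective (S.prem l) := fun i j h => by
  simpa using S.premiseAt_inj (x := .inr (.inr ⟨l, i⟩)) (y := .inr (.inr ⟨l, j⟩)) h

/-! ### Parsing by contraction of finished parts -/

/-- A stage of parsing. The links that correspond to the vertices in `U` are still to be
processed; every other value of `ρ` labels a part that is the translation of a proof. The graph that
arises by contracting these parts is correct. -/
structure ParseState (ρ : S.Node ⊕ S.Cut → S.Node ⊕ S.Cut) (U : Set (S.Node ⊕ S.Cut)) :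
    Prop where
  correct : IsCorrect (Set.range ρ) {κ | ρ (S.clusterTgt p κ) ∈ U} (ρ ∘ S.clusterTgt p)
    fun κ => ρ '' S.clusterSrc p κ
  subset_range : U ⊆ Set.range ρ
  eq_of_eq : ∀ w w', ρ w ∈ U → ρ w' = ρ w → w' = w
  axPos_notMem : ∀ a, ρ (.inl (S.axPos a)) ∉ U
  axNeg_notMem : ∀ a, ρ (.inl (S.axNeg a)) ∉ U
  proved : ∀ b ∈ Set.range ρ, b ∉ U → S.ProvedPart {v | ρ (.inl v) = b} {c | ρ (.inr c) = b}

variable {S p}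

/-- At the first stage exactly the axiom links are contracted and count as finished parts. -/
theorem exists_parseState
    (h : IsCorrect Set.univ Set.univ (S.clusterTgt p) (S.clusterSrc p)) :
    ∃ ρ U, S.ParseState p ρ U := by
  classical
  -- Each axiom link collapses onto its positive conclusion. The chosen link is unambiguous because
  -- `S.axNeg` is injective.
  let m : S.Node ⊕ S.Cut → S.Node ⊕ S.Cut := fun w =>
    if h : ∃ a, w = .inl (S.axNeg a) then .inl (S.axPos h.choose) else w
  have hneg : ∀ a, m (.inl (S.axNeg a)) = .inl (S.axPos a) := fun a => by
    have he : ∃ a', (.inl (S.axNeg a) : S.Node ⊕ S.Cut) = .inl (S.axNeg a') := ⟨a, rfl⟩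
    have := S.axNeg_injective (Sum.inl_injective he.choose_spec)
    simp only [m, dif_pos he, ← this]
  have hid : ∀ w, (∀ a, w ≠ .inl (S.axNeg a)) → m w = w := fun w hw =>
    dif_neg (by rintro ⟨a, ha⟩; exact hw a ha)
  have hpos : ∀ a, m (.inl (S.axPos a)) = .inl (S.axPos a) := fun a =>
    hid _ fun b hb => S.axPos_ne_axNeg a b (Sum.inl_injective hb)
  have hconcl : ∀ l, m (.inl (S.concl l)) = .inl (S.concl l) := fun l =>
    hid _ fun b hb => S.axNeg_ne_concl b l (Sum.inl_injective hb).symm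
  have hcut : ∀ c, m (.inr c) = .inr c := fun c => hid _ fun b hb => by simp at hb
  let U : Set (S.Node ⊕ S.Cut) := {w | (∃ c, w = .inr c) ∨ ∃ l, w = .inl (S.concl l)}
  have haxU : ∀ a, (.inl (S.axPos a) : S.Node ⊕ S.Cut) ∉ U := by
    rintro a (⟨c, hc⟩ | ⟨l, hl⟩)
    · simp at hc
    · exact S.axPos_ne_concl a l (Sum.inl_injective hl)
  have hfix : ∀ w, m w ∈ U → m w = w := by
    intro w hw
    refine hid w ?_
    rintro a rfl
    rw [hneg] at hw
    exact haxU a hw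
  refine ⟨m, U, ?_, ?_, ?_, ?_, ?_, ?_⟩
  · have hc := h.contract (Set.range Sum.inl) m
      (fun κ => κ.elim (fun a => .inl (S.axNeg a)) fun _ => S.clusterTgt p κ)
      (by rintro _ ⟨a, rfl⟩; rfl)
      (by rintro _ ⟨a, rfl⟩; exact (hpos a).trans (hneg a).symm)
      (by
        intro g hg w
        by_cases hw : ∃ a, w = .inl (S.axNeg a)
        · obtain ⟨a, rfl⟩ := hw
          rw [hneg]
          exact hg (.inl a) ⟨⟨a, rfl⟩, trivial⟩
        · rw [hid w (not_exists.1 hw)])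
    rw [Set.image_univ] at hc
    have hR : (Set.univ \ Set.range Sum.inl : Set (S.Cluster p)) =
        {κ | m (S.clusterTgt p κ) ∈ U} := by
      ext (a | ⟨c, b⟩ | x)
      · simpa [clusterTgt, hpos] using haxU a
      · simp [clusterTgt, hcut, U]
      · simp [clusterTgt, hconcl, U]
    rwa [hR] at hc
  · rintro w (⟨c, rfl⟩ | ⟨l, rfl⟩)
    exacts [⟨_, hcut c⟩, ⟨_, hconcl l⟩]
  · intro w w' hw he
    rw [← hfix w hw, ← he]
    exact (hfix w' (he ▸ hw)).symm
  · intro a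
    rw [hpos]
    exact haxU a
  · intro a
    rw [hneg]
    exact haxU a
  · intro b hb hbU
    obtain ⟨a, rfl⟩ : ∃ a, b = .inl (S.axPos a) := by
      obtain ⟨v | c, rfl⟩ := hb
      · rcases S.node_cases v with ⟨a, rfl⟩ | ⟨a, rfl⟩ | ⟨l, rfl⟩
        · exact ⟨a, hpos a⟩
        · exact ⟨a, hneg a⟩
        · exact absurd (Or.inr ⟨l, hconcl l⟩) hbU
      · exact absurd (Or.inl ⟨c, hcut c⟩) hbU
    have hN : {v | m (.inl v) = .inl (S.axPos a)} = {S.axPos a, S.axNeg a} := by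
      ext v
      rcases S.node_cases v with ⟨b, rfl⟩ | ⟨b, rfl⟩ | ⟨l, rfl⟩
      · simp [hpos, S.axPos_ne_axNeg]
      · simp [hneg, (S.axPos_ne_axNeg _ _).symm, S.axPos_injective.eq_iff,
          S.axNeg_injective.eq_iff]
      · simp [hconcl, (S.axPos_ne_concl _ _).symm, (S.axNeg_ne_concl _ _).symm]
    have hC : {c | m (.inr c) = .inl (S.axPos a)} = ∅ := by
      ext c
      simp [hcut]
    rw [hN, hC]
    exact S.provedPart_ax a

/-- The part that arises by processing the link of a vertex `u ∈ U` all of whose premises belong to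
finished parts. -/
theorem ParseState.provedPart_step {ρ : S.Node ⊕ S.Cut → S.Node ⊕ S.Cut}
    {U : Set (S.Node ⊕ S.Cut)} (h : S.ParseState p ρ U)
    (hp : ∀ l, p l ∈ (S.conn l).partitions σ) {w : S.Node ⊕ S.Cut} (hw : ρ w ∈ U)
    (hready : ∀ κ, S.clusterTgt p κ = w → ∃ b ∉ U, ρ '' S.clusterSrc p κ = {b}) :
    S.ProvedPart
      {v | .inl v = w ∨ ∃ κ, S.clusterTgt p κ = w ∧ ρ (.inl v) ∈ ρ '' S.clusterSrc p κ}
      {c | .inr c = w ∨ ∃ κ, S.clusterTgt p κ = w ∧ ρ (.inr c) ∈ ρ '' S.clusterSrc p κ} := by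
  rcases w with v | c
  · obtain ⟨l, rfl⟩ : ∃ l, v = S.concl l := by
      rcases S.node_cases v with ⟨a, rfl⟩ | ⟨a, rfl⟩ | hl
      exacts [absurd hw (h.axPos_notMem a), absurd hw (h.axNeg_notMem a), hl]
    have htgt : ∀ κ, S.clusterTgt p κ = .inl (S.concl l) ↔ ∃ x, κ = .inr (.inr ⟨l, x⟩) := by
      rintro (a | ⟨c, b⟩ | ⟨l', x⟩)
      · simp [clusterTgt, S.axPos_ne_concl]
      · simp [clusterTgt]
      · simp only [clusterTgt, Sum.inl.injEq, S.concl_injective.eq_iff, Sum.inr.injEq]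
        constructor
        · rintro rfl
          exact ⟨x, rfl⟩
        · rintro ⟨y, hy⟩
          exact congrArg Sigma.fst hy
    choose b hbU hb using fun x => hready (.inr (.inr ⟨l, x⟩)) rfl
    have hmem : ∀ j, ρ (.inl (S.prem l j)) = b (NPartition.classOf (p l) j) := fun j => by
      have : ρ (.inl (S.prem l j)) ∈
          ρ '' S.clusterSrc p (.inr (.inr ⟨l, NPartition.classOf (p l) j⟩)) :=
        ⟨_, ⟨j, (p l).mem_part (Finset.mem_univ j), rfl⟩, rfl⟩
      rwa [hb] at this
    have hbrange : ∀ x, b x ∈ Set.range ρ := fun x => by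
      have : b x ∈ ρ '' S.clusterSrc p (.inr (.inr ⟨l, x⟩)) := by rw [hb]; rfl
      exact Set.image_subset_range _ _ this
    have hR : ∀ x, (.inr (.inr ⟨l, x⟩) : S.Cluster p) ∈ {κ | ρ (S.clusterTgt p κ) ∈ U} :=
      fun _ => hw
    -- If two classes led to the same part, the contracted graph would have two parallel edges at
    -- the conclusion of `l`.
    have hdisj : Pairwise fun x y => Disjoint {v | ρ (.inl v) = b x} {v | ρ (.inl v) = b y} := by
      intro x y hxy
      refine Set.disjoint_left.2 fun v (hv : _ = _) (hv' : _ = _) => ?_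
      refine h.correct.not_parallel (hR x) (hR y) (by simpa using hxy) (a := b x) (b := b y)
        (by rw [hb]; rfl) (by rw [hb]; rfl) (Or.inl ⟨rfl, hv.symm.trans hv'⟩)
    have key := provedPart_conn l (hp l) (fun x => h.proved (b x) (hbrange x) (hbU x)) hdisj
      (fun x (hx : _ = _) => hbU x (hx ▸ hw)) hmem
    convert key using 1
    · ext v
      simp only [htgt, Set.mem_ofPred_eq, Set.mem_insert_iff, Sum.inl.injEq, Set.mem_iUnion]
      refine or_congr Iff.rfl ⟨?_, ?_⟩
      · rintro ⟨_, ⟨x, rfl⟩, hx⟩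
        rw [hb] at hx
        exact ⟨x, hx⟩
      · rintro ⟨x, hx⟩
        exact ⟨_, ⟨x, rfl⟩, by rw [hb]; exact hx⟩
    · ext c
      simp only [htgt, Set.mem_ofPred_eq, Set.mem_iUnion, reduceCtorEq, false_or]
      refine ⟨?_, ?_⟩
      · rintro ⟨_, ⟨x, rfl⟩, hx⟩
        rw [hb] at hx
        exact ⟨x, hx⟩
      · rintro ⟨x, hx⟩
        exact ⟨_, ⟨x, rfl⟩, by rw [hb]; exact hx⟩
  · have htgt : ∀ κ, S.clusterTgt p κ = .inr c ↔
        κ = .inr (.inl (c, true)) ∨ κ = .inr (.inl (c, false)) := by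
      rintro (a | ⟨c, (_ | _)⟩ | ⟨l', x⟩) <;> simp [clusterTgt]
    have hsrc : ∀ d, ρ '' S.clusterSrc p (.inr (.inl (d, true))) = {ρ (.inl (S.cutL d))} ∧
        ρ '' S.clusterSrc p (.inr (.inl (d, false))) = {ρ (.inl (S.cutR d))} := fun d =>
      ⟨Set.image_singleton, Set.image_singleton⟩
    have hLU : ρ (.inl (S.cutL c)) ∉ U := by
      obtain ⟨b, hb, he⟩ := hready (.inr (.inl (c, true))) rfl
      rw [(hsrc c).1, Set.singleton_eq_singleton_iff] at he
      rwa [he]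
    have hRU : ρ (.inl (S.cutR c)) ∉ U := by
      obtain ⟨b, hb, he⟩ := hready (.inr (.inl (c, false))) rfl
      rw [(hsrc c).2, Set.singleton_eq_singleton_iff] at he
      rwa [he]
    have hdisj : Disjoint {v | ρ (.inl v) = ρ (.inl (S.cutL c))}
        {v | ρ (.inl v) = ρ (.inl (S.cutR c))} := by
      refine Set.disjoint_left.2 fun v (hv : _ = _) (hv' : _ = _) => ?_
      exact h.correct.not_parallel (κ := .inr (.inl (c, true))) (μ := .inr (.inl (c, false)))
        hw hw (by simp) (by rw [(hsrc c).1]; rfl) (by rw [(hsrc c).2]; rfl)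
        (Or.inl ⟨rfl, hv.symm.trans hv'⟩)
    have key := provedPart_cut c (h.proved _ ⟨_, rfl⟩ hLU) (h.proved _ ⟨_, rfl⟩ hRU) hdisj rfl rfl
    convert key using 1
    · ext v
      simp only [htgt, Set.mem_ofPred_eq, or_and_right, exists_or, exists_eq_left, hsrc,
        Set.mem_singleton_iff, reduceCtorEq, false_or]
      rfl
    · ext d
      simp only [htgt, Set.mem_ofPred_eq, or_and_right, exists_or, exists_eq_left, hsrc,
        Set.mem_singleton_iff, Sum.inr.injEq]
      rfl

/-- A ready vertex absorbs all finished parts adjacent to it. This contracts every cluster of its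
link at once and removes the vertex from `U`. -/
theorem ParseState.step [Finite (S.Cluster p)] {ρ : S.Node ⊕ S.Cut → S.Node ⊕ S.Cut}
    {U : Set (S.Node ⊕ S.Cut)} (h : S.ParseState p ρ U)
    (hp : ∀ l, p l ∈ (S.conn l).partitions σ) (hU : U.Nonempty) :
    ∃ ρ', ∃ u ∈ U, S.ParseState p ρ' (U \ {u}) := by
  classical
  obtain ⟨u, hu, hready⟩ := h.correct.exists_ready U hU fun κ hκ => hκ
  obtain ⟨w, rfl⟩ := h.subset_range hu
  -- An unprocessed vertex has a one-point fibre, so the clusters at it in the quotient are exactly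
  -- those of the link of `w`.
  have hD : ∀ w', ρ w' = ρ w ↔ w' = w := fun w' => ⟨h.eq_of_eq w w' hu, fun e => by rw [e]⟩
  have hready' : ∀ κ, S.clusterTgt p κ = w → ∃ b ∉ U, ρ '' S.clusterSrc p κ = {b} := fun κ hκ =>
    hready κ (by simpa [hκ] using hu) (by simp [hκ])
  have : Nonempty (S.Node ⊕ S.Cut) := ⟨w⟩
  choose! s hsU hs using hready'
  -- The finished parts that hold the premises of the link of `w`; they are merged into `ρ w`.
  let B : Set (S.Node ⊕ S.Cut) := {v | ∃ κ, S.clusterTgt p κ = w ∧ v ∈ ρ '' S.clusterSrc p κ}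
  have hBU : ∀ v ∈ B, v ∉ U := by
    rintro v ⟨κ, hκ, hv⟩
    rw [hs κ hκ] at hv
    rw [Set.mem_singleton_iff.1 hv]
    exact hsU κ hκ
  let m : S.Node ⊕ S.Cut → S.Node ⊕ S.Cut := fun v => if v ∈ B then ρ w else v
  have hmB : ∀ v ∈ B, m v = ρ w := fun v hv => if_pos hv
  have hmU : ∀ v ∉ B, m v = v := fun v hv => if_neg hv
  have hmw : m (ρ w) = ρ w := hmU _ fun hB => hBU _ hB hu
  have hm_eq : ∀ v, m v = ρ w ↔ v = ρ w ∨ v ∈ B := by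
    intro v
    by_cases hv : v ∈ B
    · simp [hmB v hv, hv]
    · simp [hmU v hv, hv]
  have hm_mem : ∀ v, m v ∈ U \ {ρ w} → m v = v := by
    intro v hv
    by_contra hne
    exact hv.2 (hmB v (by_contra fun hB => hne (hmU v hB)))
  have hmem_iff : ∀ v, m v ∈ U \ {ρ w} ↔ v ∈ U \ {ρ w} := by
    intro v
    constructor
    · intro hv
      rwa [hm_mem v hv] at hv
    · intro hv
      rwa [hmU v fun hB => hBU v hB hv.1]
  refine ⟨m ∘ ρ, ρ w, hu, ?_, ?_, ?_, ?_, ?_, ?_⟩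
  · have hc := h.correct.contract {κ | S.clusterTgt p κ = w} m s
      (fun κ hκ => by rw [hs κ hκ]; rfl)
      (fun κ (hκ : _ = _) => by
        rw [Function.comp_apply, hκ, hmw]
        exact (hmB _ ⟨κ, hκ, by rw [hs κ hκ]; rfl⟩).symm)
      (by
        intro g hg v
        by_cases hv : v ∈ B
        · rw [hmB v hv]
          obtain ⟨κ, hκ, hvκ⟩ := hv
          rw [hs κ hκ] at hvκ
          have h1 := hg κ ⟨hκ, by simpa [hκ] using hu⟩
          rw [Function.comp_apply, hκ] at h1
          rwa [Set.mem_singleton_iff.1 hvκ]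
        · rw [hmU v hv])
    rw [← Set.range_comp] at hc
    simp only [Set.image_image] at hc
    have hR : {κ | ρ (S.clusterTgt p κ) ∈ U} \ {κ | S.clusterTgt p κ = w} =
        {κ | (m ∘ ρ) (S.clusterTgt p κ) ∈ U \ {ρ w}} := by
      ext κ
      simp only [Function.comp_apply, Set.mem_ofPred_eq, hmem_iff]
      simp [hD]
    rw [hR] at hc
    exact hc
  · intro v hv
    obtain ⟨w', rfl⟩ := h.subset_range hv.1
    exact ⟨w', hmU _ fun hB => hBU _ hB hv.1⟩
  · intro w₁ w₂ hw₁ he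
    have h1 := hm_mem _ hw₁
    have h2 := hm_mem (ρ w₂) (by
      rw [Function.comp_apply] at he
      rw [he]
      exact hw₁)
    exact h.eq_of_eq w₁ w₂ ((hmem_iff _).1 hw₁).1 (h2.symm.trans (he.trans h1))
  · exact fun a ha => h.axPos_notMem a ((hmem_iff _).1 ha).1
  · exact fun a ha => h.axNeg_notMem a ((hmem_iff _).1 ha).1
  · rintro _ ⟨w', rfl⟩ hbU
    by_cases hbu : m (ρ w') = ρ w
    · have key := h.provedPart_step hp hu fun κ hκ => ⟨s κ, hsU κ hκ, hs κ hκ⟩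
      convert key using 1
      · ext v
        simp only [Function.comp_apply, hbu, Set.mem_ofPred_eq, hm_eq, hD]
        rfl
      · ext c
        simp only [Function.comp_apply, hbu, Set.mem_ofPred_eq, hm_eq, hD]
        rfl
    · have hB : ρ w' ∉ B := fun hB => hbu (hmB _ hB)
      -- A part that is not absorbed keeps its fibre, so its proof carries over.
      have hfib : ∀ v, m (ρ v) = m (ρ w') ↔ ρ v = ρ w' := by
        intro v
        refine ⟨fun he => ?_, fun he => by rw [he]⟩
        have hBv : ρ v ∉ B := fun hBv => hbu (he ▸ hmB _ hBv)
        rwa [hmU _ hBv, hmU _ hB] at he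
      simp only [Function.comp_apply, hfib]
      refine h.proved _ ⟨w', rfl⟩ fun hU' => hbU ?_
      refine (hmem_iff _).2 ⟨hU', fun he => hbu ?_⟩
      rw [Set.mem_singleton_iff.1 he, hmw]

theorem ParseState.sequentializable [Finite (S.Cluster p)]
    {ρ : S.Node ⊕ S.Cut → S.Node ⊕ S.Cut} {U : Set (S.Node ⊕ S.Cut)} (h : S.ParseState p ρ U)
    (hU : U.Finite) (hp : ∀ l, p l ∈ (S.conn l).partitions σ) : S.Sequentializable := by
  induction hn : U.ncard generalizing ρ U with
  | zero =>
    obtain rfl := (Set.ncard_eq_zero hU).1 hn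
    obtain ⟨v₀⟩ := S.nonempty
    -- With nothing left to process no cluster remains, so the quotient is a single point and its
    -- fibre is all of `S`.
    have hsub := h.correct.subsingleton_of_empty (by ext; simp)
    have key := h.proved (ρ (.inl v₀)) ⟨_, rfl⟩ (by simp)
    have hρ : ∀ w, ρ w = ρ (.inl v₀) := fun w => hsub ⟨w, rfl⟩ ⟨_, rfl⟩
    simp only [hρ] at key
    exact ProvedPart.sequentializable (by simpa using key)
  | succ n ih =>
    have hne : U.Nonempty := Set.nonempty_of_ncard_ne_zero (by omega)
    obtain ⟨ρ', u, hu, h'⟩ := h.step hp hne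
    refine ih h' (hU.subset Set.sdiff_subset) ?_
    rw [Set.ncard_sdiff_singleton_of_mem hu, hn]
    rfl

theorem IsProofNetFor.sequentializable (hp : ∀ l, p l ∈ (S.conn l).partitions σ)
    (h : S.IsProofNetFor p) : S.Sequentializable := by
  have := S.finite
  have : Finite S.Ax := Finite.of_injective _ S.axPos_injective
  have : Finite S.Cut := Finite.of_injective _ S.cutL_injective
  have : Finite S.CLink := Finite.of_injective _ S.concl_injective
  obtain ⟨ρ, U, hρ⟩ := exists_parseState (isCorrect_cluster hp S.prem_injective h)
  exact hρ.sequentializable U.toFinite hp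

end ProofStructure

theorem Conn.partitions_nonempty {ι : Type u} (σ : Signature ι) (c : Conn ι) :
    (c.partitions σ).Nonempty := by
  cases c with
  | tensor => exact Set.singleton_nonempty _
  | par => exact Set.singleton_nonempty _
  | gen i => exact (σ.pair i).pos_nonempty
  | dual i => exact (σ.pair i).neg_nonempty

/-- Sequentialization: every proof-net in the sense of the partition switching is sequentializable.
It is already enough that the correctness condition holds for the switchings of one fixed choice of
a partition for each link. -/
theorem mainTheorem1 {ι : Type u} {σ : Signature ι} (S : ProofStructure σ) :
    (S.IsProofNet → S.Sequentializable) ∧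
      ∀ p : (l : S.CLink) → NPartition ((S.conn l).arity σ),
        (∀ l, p l ∈ (S.conn l).partitions σ) → S.IsProofNetFor p → S.Sequentializable := by
  refine ⟨fun h => ?_, fun p hp h => h.sequentializable hp⟩
  -- A proof-net satisfies the weaker condition for any choice of partitions, and one exists because
  -- the partition sets are non-empty.
  exact ProofStructure.IsProofNetFor.sequentializable
    (p := fun l => ((S.conn l).partitions_nonempty σ).some)
    (fun l => ((S.conn l).partitions_nonempty σ).some_mem) fun I _ => h I
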